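/- Let $(X,Y_1,Y_2)$ be random variables with finite alphabets $\mathcal X,\mathcal Y_1,\mathcal Y_2$ and joint pmf $P_{X,Y_1,Y_2}$ such that $Y_1 - X - Y_2$ is a Markov chain. Let $\mathcal{RD}_{\mathrm{CEO}}$ be the single-letter rate-distortion region of the two-encoder CEO problem under logarithmic loss, i.e. the set of all $(R_1,R_2,D)\in\mathbb R^3$ such that $$R_1\ge I(U_1;Y_1|U_2,Q),\quad R_2\ge I(U_2;Y_2|U_1,Q),\quad R_1+R_2\ge I(U_1,U_2;Y_1,Y_2|Q),\quad D\ge H(X|U_1,U_2,Q)$$ for some pmf $p(x)p(y_1|x)p(y_2|x)p(u_1|y_1,q)p(u_2|y_2,q)p(q)$ with $|\mathcal U_1|\le|\mathcal Y_1|$, $|\mathcal U_2|\le|\mathcal Y_2|$, $|\mathcal Q|\le 4$. For $i\in\{1,2\}$ let $i^{\mathsf c}$ be the other element of $\{1,2\}$, and let $$D^i_{\mathrm{CEO}}(R_1,R_2)=\min H(X|U_1,U_2)\quad\text{subject to}\quad R_i\ge I(Y_i;U_i|U_{i^{\mathsf c}}),\ \ R_{i^{\mathsf c}}\ge I(Y_{i^{\mathsf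 c}};U_{i^{\mathsf c}}),$$ where the minimum is over all joint pmfs $P_{U_1,U_2,X,Y_1,Y_2}$, with $U_1,U_2$ in arbitrary finite alphabets, that have the given marginal $P_{X,Y_1,Y_2}$ and satisfy the Markov chain $U_1 - Y_1 - X - Y_2 - U_2$; the minimum over the empty set is $+\infty$. Put $\mathcal{RD}^i_{\mathrm{CEO}}=\{(R_1,R_2,D)\in\mathbb R^3: D\ge D^i_{\mathrm{CEO}}(R_1,R_2)\}$. Then the minimum is attained whenever the constraints can be met, and $$\mathcal{RD}_{\mathrm{CEO}}=\mathrm{conv}\left(\mathcal{RD}^1_{\mathrm{CEO}}\cup\mathcal{RD}^2_{\mathrm{CEO}}\right).$$ -/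

import Mathlib

/-!
Discrete random variables are maps `f : Ω → α` on a finite sample space `Ω` that carries a
probability mass function `p : Ω → ℝ` (an element of `stdSimplex ℝ Ω`). Entropies are in nats.
-/

namespace CEO

section Information

variable {Ω α β γ : Type*} [Fintype Ω]

open Classical in
/-- `prob p f a` is the probability `P(f = a)` under the pmf `p`. -/
noncomputable def prob (p : Ω → ℝ) (f : Ω → α) (a : α) : ℝ :=
  ∑ ω with f ω = a, p ω

/-- The Shannon entropy `H(f) = -∑ₐ P(f = a) log P(f = a)`, where `0 log 0 = 0`. -/
noncomputable def entropy [Fintype α] (p : Ω → ℝ) (f : Ω → α) : ℝ :=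
  ∑ a, Real.negMulLog (prob p f a)

/-- The conditional entropy `H(f | g) = ∑ P(f = a, g = b) log (1 / P(f = a | g = b))`; the
terms with `P(f = a, g = b) = 0` vanish. -/
noncomputable def condEntropy [Fintype α] [Fintype β] (p : Ω → ℝ) (f : Ω → α) (g : Ω → β) : ℝ :=
  ∑ a, ∑ b, prob p (fun ω => (f ω, g ω)) (a, b) *
    Real.log (prob p g b / prob p (fun ω => (f ω, g ω)) (a, b))

/-- The mutual information `I(f; g) = H(f) - H(f | g)`. -/
noncomputable def mutualInfo [Fintype α] [Fintype β] (p : Ω → ℝ) (f : Ω → α) (g : Ω → β) : ℝ :=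
  entropy p f - condEntropy p f g

/-- The conditional mutual information `I(f; g | h) = H(f | h) - H(f | g, h)`. -/
noncomputable def condMutualInfo [Fintype α] [Fintype β] [Fintype γ]
    (p : Ω → ℝ) (f : Ω → α) (g : Ω → β) (h : Ω → γ) : ℝ :=
  condEntropy p f h - condEntropy p f (fun ω => (g ω, h ω))

/-- The Markov chain `f - g - h`: `f` and `h` are conditionally independent given `g`. -/
def MarkovChain (p : Ω → ℝ) (f : Ω → α) (g : Ω → β) (h : Ω → γ) : Prop :=
  ∀ a b c, prob p (fun ω => (f ω, g ω, h ω)) (a, b, c) * prob p g b =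
    prob p (fun ω => (f ω, g ω)) (a, b) * prob p (fun ω => (g ω, h ω)) (b, c)

end Information

/-! ### Coordinates of `(X, Y₁, Y₂, U₁, U₂)` -/

section Coordinates

variable {𝒳 𝒴₁ 𝒴₂ 𝒰₁ 𝒰₂ : Type*}

abbrev rvX (ω : 𝒳 × 𝒴₁ × 𝒴₂ × 𝒰₁ × 𝒰₂) : 𝒳 := ω.1
abbrev rvY₁ (ω : 𝒳 × 𝒴₁ × 𝒴₂ × 𝒰₁ × 𝒰₂) : 𝒴₁ := ω.2.1
abbrev rvY₂ (ω : 𝒳 × 𝒴₁ × 𝒴₂ × 𝒰₁ × 𝒰₂) : 𝒴₂ := ω.2.2.1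
abbrev rvU₁ (ω : 𝒳 × 𝒴₁ × 𝒴₂ × 𝒰₁ × 𝒰₂) : 𝒰₁ := ω.2.2.2.1
abbrev rvU₂ (ω : 𝒳 × 𝒴₁ × 𝒴₂ × 𝒰₁ × 𝒰₂) : 𝒰₂ := ω.2.2.2.2

end Coordinates

section Regions

variable {𝒳 𝒴₁ 𝒴₂ : Type*} [Fintype 𝒳] [Fintype 𝒴₁] [Fintype 𝒴₂]

/-- `P` is the joint pmf of a source `(X, Y₁, Y₂)` satisfying the Markov chain `Y₁ - X - Y₂`. -/
structure IsSource (P : 𝒳 × 𝒴₁ × 𝒴₂ → ℝ) : Prop where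
  pmf : P ∈ stdSimplex ℝ (𝒳 × 𝒴₁ × 𝒴₂)
  markov : MarkovChain P (fun ω => ω.2.1) (fun ω => ω.1) (fun ω => ω.2.2)

/-- The joint pmf `p(q) p(x, y₁, y₂) p(u₁ | y₁, q) p(u₂ | y₂, q)` on the tuples
`(q, x, y₁, y₂, u₁, u₂)`; for a source, `p(x, y₁, y₂) = p(x) p(y₁ | x) p(y₂ | x)`. -/
def timeSharingLaw {𝒬 𝒰₁ 𝒰₂ : Type*} (P : 𝒳 × 𝒴₁ × 𝒴₂ → ℝ) (pQ : 𝒬 → ℝ)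
    (W₁ : 𝒬 → 𝒴₁ → 𝒰₁ → ℝ) (W₂ : 𝒬 → 𝒴₂ → 𝒰₂ → ℝ)
    (ω : 𝒬 × 𝒳 × 𝒴₁ × 𝒴₂ × 𝒰₁ × 𝒰₂) : ℝ :=
  pQ ω.1 * P (rvX ω.2, rvY₁ ω.2, rvY₂ ω.2) *
    W₁ ω.1 (rvY₁ ω.2) (rvU₁ ω.2) * W₂ ω.1 (rvY₂ ω.2) (rvU₂ ω.2)

/-- The rate-distortion region of the two-encoder CEO problem under log-loss, in single-letter
form: the tuples `(R₁, R₂, D)` for which there are auxiliary variables `U₁`, `U₂` and a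
time-sharing variable `Q`, with `|𝒬| ≤ 4` and `|𝒰ᵢ| ≤ |𝒴ᵢ|`, that satisfy the rate and
distortion constraints. -/
def RD (P : 𝒳 × 𝒴₁ × 𝒴₂ → ℝ) : Set (ℝ × ℝ × ℝ) :=
  {r | ∃ m n₁ n₂ : ℕ, m ≤ 4 ∧ n₁ ≤ Fintype.card 𝒴₁ ∧ n₂ ≤ Fintype.card 𝒴₂ ∧
    ∃ (pQ : Fin m → ℝ) (W₁ : Fin m → 𝒴₁ → Fin n₁ → ℝ) (W₂ : Fin m → 𝒴₂ → Fin n₂ → ℝ),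
      pQ ∈ stdSimplex ℝ (Fin m) ∧
      (∀ q y, W₁ q y ∈ stdSimplex ℝ (Fin n₁)) ∧
      (∀ q y, W₂ q y ∈ stdSimplex ℝ (Fin n₂)) ∧
      condMutualInfo (timeSharingLaw P pQ W₁ W₂)
        (fun ω => rvU₁ ω.2) (fun ω => rvY₁ ω.2) (fun ω => (rvU₂ ω.2, ω.1)) ≤ r.1 ∧
      condMutualInfo (timeSharingLaw P pQ W₁ W₂)
        (fun ω => rvU₂ ω.2) (fun ω => rvY₂ ω.2) (fun ω => (rvU₁ ω.2, ω.1)) ≤ r.2.1 ∧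
      condMutualInfo (timeSharingLaw P pQ W₁ W₂)
        (fun ω => (rvU₁ ω.2, rvU₂ ω.2)) (fun ω => (rvY₁ ω.2, rvY₂ ω.2)) (fun ω => ω.1)
          ≤ r.1 + r.2.1 ∧
      condEntropy (timeSharingLaw P pQ W₁ W₂)
        (fun ω => rvX ω.2) (fun ω => (rvU₁ ω.2, rvU₂ ω.2, ω.1)) ≤ r.2.2}

/-- `μ` is a joint pmf of `(X, Y₁, Y₂, U₁, U₂)` whose `(X, Y₁, Y₂)`-marginal is `P` and which
satisfies the Markov chain `U₁ - Y₁ - X - Y₂ - U₂`. -/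
structure IsAuxiliaryLaw {𝒰₁ 𝒰₂ : Type*} [Fintype 𝒰₁] [Fintype 𝒰₂] (P : 𝒳 × 𝒴₁ × 𝒴₂ → ℝ)
    (μ : 𝒳 × 𝒴₁ × 𝒴₂ × 𝒰₁ × 𝒰₂ → ℝ) : Prop where
  pmf : μ ∈ stdSimplex ℝ (𝒳 × 𝒴₁ × 𝒴₂ × 𝒰₁ × 𝒰₂)
  marginal : ∀ t, prob μ (fun ω => (rvX ω, rvY₁ ω, rvY₂ ω)) t = P t
  markov₁ : MarkovChain μ rvU₁ rvY₁ (fun ω => (rvX ω, rvY₂ ω, rvU₂ ω))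
  markov₂ : MarkovChain μ (fun ω => (rvU₁ ω, rvY₁ ω)) rvX (fun ω => (rvY₂ ω, rvU₂ ω))
  markov₃ : MarkovChain μ (fun ω => (rvU₁ ω, rvY₁ ω, rvX ω)) rvY₂ rvU₂

/-- The successive Wyner-Ziv rate constraints. The index `0 : Fin 2` is the order `i = 1`:
`R₁ ≥ I(Y₁; U₁ | U₂)` and `R₂ ≥ I(Y₂; U₂)`. The index `1 : Fin 2` is the order `i = 2`:
`R₂ ≥ I(Y₂; U₂ | U₁)` and `R₁ ≥ I(Y₁; U₁)`. -/
def SWZConstraint {𝒰₁ 𝒰₂ : Type*} [Fintype 𝒰₁] [Fintype 𝒰₂]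
    (μ : 𝒳 × 𝒴₁ × 𝒴₂ × 𝒰₁ × 𝒰₂ → ℝ) (R₁ R₂ : ℝ) : Fin 2 → Prop
  | 0 => condMutualInfo μ rvY₁ rvU₁ rvU₂ ≤ R₁ ∧ mutualInfo μ rvY₂ rvU₂ ≤ R₂
  | 1 => condMutualInfo μ rvY₂ rvU₂ rvU₁ ≤ R₂ ∧ mutualInfo μ rvY₁ rvU₁ ≤ R₁

/-- The values `H(X | U₁, U₂)` of the feasible points of the minimization problem that defines
the distortion-rate function; the auxiliary alphabets are finite, of any size. -/
def feasibleValues (P : 𝒳 × 𝒴₁ × 𝒴₂ → ℝ) (i : Fin 2) (R₁ R₂ : ℝ) : Set ℝ :=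
  {d | ∃ (n₁ n₂ : ℕ) (μ : 𝒳 × 𝒴₁ × 𝒴₂ × Fin n₁ × Fin n₂ → ℝ),
    IsAuxiliaryLaw P μ ∧ SWZConstraint μ R₁ R₂ i ∧
      d = condEntropy μ rvX (fun ω => (rvU₁ ω, rvU₂ ω))}

/-- The distortion-rate function: the minimum of `H(X | U₁, U₂)` under the successive Wyner-Ziv
constraints, `+∞` if they cannot be met. -/
noncomputable def distortionRate (P : 𝒳 × 𝒴₁ × 𝒴₂ → ℝ) (i : Fin 2) (R₁ R₂ : ℝ) : EReal :=
  sInf ((fun d : ℝ => (d : EReal)) '' feasibleValues P i R₁ R₂)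

/-- The region of the tuples `(R₁, R₂, D)` that lie on or above the graph of the
distortion-rate function. -/
def RDSucc (P : 𝒳 × 𝒴₁ × 𝒴₂ → ℝ) (i : Fin 2) : Set (ℝ × ℝ × ℝ) :=
  {r | distortionRate P i r.1 r.2.1 ≤ (r.2.2 : EReal)}

end Regions

end CEO

/-! A pair of channels `W₁`, `W₂` matters only through four numbers, collected in `infoVector`:
I(U₁,U₂;Y₁,Y₂), I(U₁;Y₁), I(U₂;Y₂) and H(X|U₁,U₂). Given Y₁, the variable U₁ is independent of U₂,
so I(U₁;Y₁|U₂) is the first number minus the third; the other order is symmetric. For a fixed vector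
the rate constraints cut out a polyhedron whose vertices are the two successive Wyner-Ziv points
`corner 0` and `corner 1`, so every point of it dominates a convex combination of them
(`exists_convex_combination_corner_le`). Since `corner` is linear, it commutes with time sharing,
and `RD` lies in the convex hull.

For the reverse inclusion the auxiliary alphabets must shrink. With one channel fixed, `infoVector`
is a sum of a homogeneous function over the columns of the other, so reweighting columns acts
linearly on it. Among the weights that keep the channel stochastic, the extreme ones live on
linearly independent columns, at most |𝒴ᵢ| of them. Hence every information vector is a convex
combination of vectors from small alphabets (`infoVector_mem_convexHull`), and Carathéodory's
theorem in ℝ³ leaves at most four time-sharing values.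

Appending the information vector to each column makes the same reduction preserve it exactly, with
four more letters. The feasible values are then a continuous image of a compact set
(`isCompact_feasibleValues`); the minimum is attained, and the infimum in `RDSucc` is realized by
actual channels. -/

namespace CEO

/-! ### Entropy identities on a finite probability space. -/

section Information

variable {Ω α β γ δ : Type*} [Fintype Ω] {p : Ω → ℝ}

theorem prob_nonneg (hp : 0 ≤ p) (f : Ω → α) (a : α) : 0 ≤ prob p f a :=
  Finset.sum_nonneg fun ω _ => hp ω

open Classical in
theorem prob_eq_sum_ite (p : Ω → ℝ) (f : Ω → α) (a : α) :
    prob p f a = ∑ ω, if f ω = a then p ω else 0 := by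
  rw [prob, Finset.sum_filter]

theorem sum_prob_mul [Fintype α] (p : Ω → ℝ) (f : Ω → α) (F : α → ℝ) :
    ∑ a, prob p f a * F a = ∑ ω, p ω * F (f ω) := by
  classical
  simp only [prob_eq_sum_ite, Finset.sum_mul, ite_mul, zero_mul]
  rw [Finset.sum_comm]
  simp

theorem sum_prob [Fintype α] (p : Ω → ℝ) (f : Ω → α) : ∑ a, prob p f a = ∑ ω, p ω := by
  simpa using sum_prob_mul p f fun _ => 1

theorem sum_prob_prodMk_left [Fintype α] (p : Ω → ℝ) (f : Ω → α) (g : Ω → β) (b : β) :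
    ∑ a, prob p (fun ω => (f ω, g ω)) (a, b) = prob p g b := by
  classical
  simp only [prob_eq_sum_ite, Prod.mk.injEq, ite_and]
  rw [Finset.sum_comm]
  simp

theorem sum_prob_prodMk_right [Fintype β] (p : Ω → ℝ) (f : Ω → α) (g : Ω → β) (a : α) :
    ∑ b, prob p (fun ω => (f ω, g ω)) (a, b) = prob p f a := by
  classical
  simp only [prob_eq_sum_ite, Prod.mk.injEq, ite_and]
  rw [Finset.sum_comm]
  refine Finset.sum_congr rfl fun ω _ => ?_
  split_ifs <;> simp

theorem prob_equiv_comp (p : Ω → ℝ) (f : Ω → α) (e : α ≃ β) (a : α) :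
    prob p (fun ω => e (f ω)) (e a) = prob p f a := by
  classical
  simp [prob_eq_sum_ite]

theorem entropy_equiv_comp [Fintype α] [Fintype β] (p : Ω → ℝ) (f : Ω → α) (e : α ≃ β) :
    entropy p (fun ω => e (f ω)) = entropy p f := by
  simp only [entropy, ← e.sum_comp, prob_equiv_comp]

theorem prob_le_prob_right (hp : 0 ≤ p) [Fintype α] (f : Ω → α) (g : Ω → β) (a : α) (b : β) :
    prob p (fun ω => (f ω, g ω)) (a, b) ≤ prob p g b := by
  rw [← sum_prob_prodMk_left p f g b]
  exact Finset.single_le_sum (f := fun a => prob p (fun ω => (f ω, g ω)) (a, b))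
    (fun a _ => prob_nonneg hp _ _) (Finset.mem_univ a)

theorem condEntropy_eq_entropy_sub [Fintype α] [Fintype β] (hp : 0 ≤ p) (f : Ω → α) (g : Ω → β) :
    condEntropy p f g = entropy p (fun ω => (f ω, g ω)) - entropy p g := by
  have h : ∀ a b, prob p (fun ω => (f ω, g ω)) (a, b) *
      Real.log (prob p g b / prob p (fun ω => (f ω, g ω)) (a, b)) =
      Real.negMulLog (prob p (fun ω => (f ω, g ω)) (a, b)) +
        prob p (fun ω => (f ω, g ω)) (a, b) * Real.log (prob p g b) := by
    intro a b
    rcases (prob_nonneg hp (fun ω => (f ω, g ω)) (a, b)).eq_or_lt with h0 | h0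
    · simp [← h0]
    · rw [Real.log_div (h0.trans_le (prob_le_prob_right hp f g a b)).ne' h0.ne', Real.negMulLog]
      ring
  simp only [condEntropy, entropy, h, Finset.sum_add_distrib, Fintype.sum_prod_type]
  rw [Finset.sum_comm (f := fun a b => prob p (fun ω => (f ω, g ω)) (a, b) * _)]
  simp only [← Finset.sum_mul, sum_prob_prodMk_left, sub_eq_add_neg, ← Finset.sum_neg_distrib,
    Real.negMulLog, neg_mul, neg_neg]

theorem condEntropy_equiv_comp_right [Fintype α] [Fintype β] [Fintype γ] (p : Ω → ℝ)
    (f : Ω → α) (g : Ω → β) (e : β ≃ γ) :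
    condEntropy p f (fun ω => e (g ω)) = condEntropy p f g := by
  simp only [condEntropy, ← e.sum_comp, prob_equiv_comp]
  refine Finset.sum_congr rfl fun a _ => Finset.sum_congr rfl fun b _ => ?_
  rw [← prob_equiv_comp p (fun ω => (f ω, g ω)) ((Equiv.refl α).prodCongr e) (a, b)]
  rfl

theorem mutualInfo_comm [Fintype α] [Fintype β] (hp : 0 ≤ p) (f : Ω → α) (g : Ω → β) :
    mutualInfo p f g = mutualInfo p g f := by
  simp only [mutualInfo, condEntropy_eq_entropy_sub hp]
  rw [← entropy_equiv_comp p (fun ω => (f ω, g ω)) (Equiv.prodComm α β)]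
  simp only [Equiv.prodComm_apply, Prod.swap_prod_mk]
  ring

theorem condMutualInfo_comm [Fintype α] [Fintype β] [Fintype γ] (hp : 0 ≤ p)
    (f : Ω → α) (g : Ω → β) (h : Ω → γ) :
    condMutualInfo p f g h = condMutualInfo p g f h := by
  simp only [condMutualInfo, condEntropy_eq_entropy_sub hp]
  rw [← entropy_equiv_comp p (fun ω => (f ω, g ω, h ω))
    ((Equiv.prodAssoc α β γ).symm.trans (((Equiv.prodComm α β).prodCongr (Equiv.refl γ)).trans
      (Equiv.prodAssoc β α γ)))]
  simp only [Equiv.trans_apply, Equiv.prodAssoc_symm_apply, Equiv.prodCongr_apply, Prod.map,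
    Equiv.prodComm_apply, Prod.swap_prod_mk, Equiv.refl_apply, Equiv.prodAssoc_apply]
  ring

/-- The conditional entropy of a variable that is generated from `g` by a stochastic kernel. -/
theorem condEntropy_of_kernel [Fintype α] [Fintype β] (hp : 0 ≤ p) {f : Ω → α} {g : Ω → β}
    {K : β → α → ℝ} (hK : ∀ b, ∑ a, K b a = 1)
    (h : ∀ a b, prob p (fun ω => (f ω, g ω)) (a, b) = prob p g b * K b a) :
    condEntropy p f g = ∑ ω, p ω * ∑ a, Real.negMulLog (K (g ω) a) := by
  rw [← sum_prob_mul p g fun b => ∑ a, Real.negMulLog (K b a), condEntropy_eq_entropy_sub hp,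
    entropy, Fintype.sum_prod_type_right, entropy, ← Finset.sum_sub_distrib]
  refine Finset.sum_congr rfl fun b _ => ?_
  simp only [h, Real.negMulLog_mul, Finset.sum_add_distrib, ← Finset.sum_mul, ← Finset.mul_sum,
    hK]
  ring

/-- Entropy is subadditive. -/
theorem entropy_prodMk_le [Fintype α] [Fintype β] (hp : 0 ≤ p) (hp1 : ∑ ω, p ω = 1)
    (f : Ω → α) (g : Ω → β) :
    entropy p (fun ω => (f ω, g ω)) ≤ entropy p f + entropy p g := by
  -- The last bracket sums to 1 - 1 = 0 over all pairs, so it disappears on summation.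
  have key : ∀ a b, Real.negMulLog (prob p (fun ω => (f ω, g ω)) (a, b)) ≤
      -prob p (fun ω => (f ω, g ω)) (a, b) * Real.log (prob p f a) -
      prob p (fun ω => (f ω, g ω)) (a, b) * Real.log (prob p g b) +
      (prob p f a * prob p g b - prob p (fun ω => (f ω, g ω)) (a, b)) := by
    intro a b
    have hle1 := prob_le_prob_right hp f g a b
    have hle2 : prob p (fun ω => (f ω, g ω)) (a, b) ≤ prob p f a := by
      rw [← sum_prob_prodMk_right p f g a]
      exact Finset.single_le_sum (f := fun b => prob p (fun ω => (f ω, g ω)) (a, b))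
        (fun b _ => prob_nonneg hp _ _) (Finset.mem_univ b)
    rcases (prob_nonneg hp (fun ω => (f ω, g ω)) (a, b)).eq_or_lt with h0 | h0
    · have := mul_nonneg (prob_nonneg hp f a) (prob_nonneg hp g b)
      simpa [← h0] using this
    · have ha := h0.trans_le hle2
      have hb := h0.trans_le hle1
      -- This is log t ≤ t - 1 at t = P(a)P(b)/P(a,b), to be multiplied by P(a,b).
      have h1 := Real.log_le_sub_one_of_pos (div_pos (mul_pos ha hb) h0)
      rw [Real.log_div (mul_pos ha hb).ne' h0.ne', Real.log_mul ha.ne' hb.ne'] at h1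
      have h2 := mul_le_mul_of_nonneg_left h1 h0.le
      rw [mul_sub, mul_sub, mul_div_cancel₀ _ h0.ne'] at h2
      rw [Real.negMulLog]
      linarith
  have hsum := Finset.sum_le_sum fun a (_ : a ∈ Finset.univ) =>
    Finset.sum_le_sum fun b (_ : b ∈ Finset.univ) => key a b
  simp only [Finset.sum_add_distrib, Finset.sum_sub_distrib, ← Finset.mul_sum, sum_prob, hp1,
    ← Finset.sum_mul, Finset.sum_neg_distrib, sum_prob_prodMk_right, mul_one, sub_self,
    add_zero] at hsum
  rw [Finset.sum_comm (f := fun a b => prob p (fun ω => (f ω, g ω)) (a, b) * _)] at hsum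
  simp only [← Finset.sum_mul, sum_prob_prodMk_left] at hsum
  simp only [entropy, Fintype.sum_prod_type]
  refine hsum.trans_eq ?_
  simp only [Real.negMulLog, sub_eq_add_neg, ← Finset.sum_neg_distrib, neg_mul]

end Information

/-! ### Information quantities conditioned on a time-sharing variable. -/

section TimeSharing

variable {𝒬 Ω α β γ : Type*} [Fintype 𝒬] [Fintype Ω] [Fintype α] [Fintype β] [Fintype γ]
  {pQ : 𝒬 → ℝ} {μ : 𝒬 → Ω → ℝ} {ν : 𝒬 × Ω → ℝ}

theorem prob_mixture {α : Type*} (hν : ∀ q ω, ν (q, ω) = pQ q * μ q ω) (f : Ω → α)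
    (a : α) (q : 𝒬) :
    prob ν (fun ω => (f ω.2, ω.1)) (a, q) = pQ q * prob (μ q) f a := by
  classical
  simp only [prob_eq_sum_ite, Fintype.sum_prod_type, Prod.mk.injEq, ite_and, hν, Finset.mul_sum,
    mul_ite, mul_zero]
  rw [Finset.sum_eq_single q] <;> simp +contextual

/-- The weight `pQ q` cancels in the ratio under the logarithm; when it is zero, both terms vanish.
-/
theorem condEntropy_mixture (hν : ∀ q ω, ν (q, ω) = pQ q * μ q ω) (f : Ω → α) (g : Ω → β) :
    condEntropy ν (fun ω => f ω.2) (fun ω => (g ω.2, ω.1)) =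
      ∑ q, pQ q * condEntropy (μ q) f g := by
  have h : ∀ a b q, prob ν (fun ω => (f ω.2, g ω.2, ω.1)) (a, b, q) =
      pQ q * prob (μ q) (fun ω => (f ω, g ω)) (a, b) := by
    intro a b q
    rw [← prob_mixture hν, ← prob_equiv_comp ν _ (Equiv.prodAssoc α β 𝒬)]
    rfl
  simp only [condEntropy, Finset.mul_sum, Fintype.sum_prod_type, h, prob_mixture hν]
  simp only [Finset.sum_comm (s := (Finset.univ : Finset β)) (t := (Finset.univ : Finset 𝒬))]
  rw [Finset.sum_comm]
  refine Finset.sum_congr rfl fun q _ => Finset.sum_congr rfl fun a _ =>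
    Finset.sum_congr rfl fun b _ => ?_
  rcases eq_or_ne (pQ q) 0 with h0 | h0
  · simp [h0]
  · rw [mul_div_mul_left _ _ h0, mul_assoc]

theorem condMutualInfo_mixture (hν : ∀ q ω, ν (q, ω) = pQ q * μ q ω) (f : Ω → α) (g : Ω → β)
    (h : Ω → γ) :
    condMutualInfo ν (fun ω => f ω.2) (fun ω => g ω.2) (fun ω => (h ω.2, ω.1)) =
      ∑ q, pQ q * condMutualInfo (μ q) f g h := by
  have := condEntropy_equiv_comp_right ν (fun ω => f ω.2) (fun ω => ((g ω.2, h ω.2), ω.1))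
    (Equiv.prodAssoc β γ 𝒬)
  simp only [Equiv.prodAssoc_apply] at this
  rw [condMutualInfo, this, condEntropy_mixture hν,
    condEntropy_mixture hν f fun ω => (g ω, h ω), ← Finset.sum_sub_distrib]
  simp only [condMutualInfo, mul_sub]

theorem prob_fst_mixture (hν : ∀ q ω, ν (q, ω) = pQ q * μ q ω) (hμ : ∀ q, ∑ ω, μ q ω = 1)
    (q : 𝒬) : prob ν (fun ω => ω.1) q = pQ q := by
  classical
  simp only [prob_eq_sum_ite, Fintype.sum_prod_type, hν]
  rw [Finset.sum_eq_single q] <;> simp +contextual [← Finset.mul_sum, hμ]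

theorem condMutualInfo_mixture_fst (hν : ∀ q ω, ν (q, ω) = pQ q * μ q ω)
    (hμ : ∀ q, ∑ ω, μ q ω = 1) (f : Ω → α) (g : Ω → β) :
    condMutualInfo ν (fun ω => f ω.2) (fun ω => g ω.2) (fun ω => ω.1) =
      ∑ q, pQ q * mutualInfo (μ q) f g := by
  rw [condMutualInfo, condEntropy_mixture hν]
  simp only [mutualInfo, mul_sub, Finset.sum_sub_distrib, sub_left_inj]
  simp only [condEntropy, entropy, Finset.mul_sum, prob_mixture hν, prob_fst_mixture hν hμ]
  rw [Finset.sum_comm]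
  refine Finset.sum_congr rfl fun q _ => Finset.sum_congr rfl fun a _ => ?_
  rcases eq_or_ne (pQ q) 0 with h0 | h0
  · simp [h0]
  · rw [div_mul_cancel_left₀ h0, Real.log_inv, Real.negMulLog]
    ring

end TimeSharing

/-! ### Reducing the support of nonnegative weights. -/

section Caratheodory

variable {U V : Type*} [Fintype U] [AddCommGroup V] [Module ℝ V]

/-- Moving from nonnegative weights along a direction with a negative entry, one reaches weights
with smaller support. -/
theorem exists_pos_add_smul_support_ssubset {w c : U → ℝ} (hw : 0 ≤ w)
    (hc : ∀ u, w u = 0 → c u = 0) (hneg : ∃ u, c u < 0) :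
    ∃ t : ℝ, 0 < t ∧ 0 ≤ w + t • c ∧ Function.support (w + t • c) ⊂ Function.support w := by
  classical
  obtain ⟨u₁, hu₁⟩ := hneg
  have hpos : ∀ u, c u < 0 → 0 < w u := fun u hu =>
    (hw u).lt_of_ne fun h => hu.ne (hc u h.symm)
  -- `u₀` is a coordinate that reaches zero first along the ray.
  obtain ⟨u₀, hu₀, hmin⟩ := Finset.exists_min_image (Finset.univ.filter fun u => c u < 0)
    (fun u => w u / -c u) ⟨u₁, by simpa using hu₁⟩
  simp only [Finset.mem_filter, Finset.mem_univ, true_and] at hu₀ hmin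
  have ht : 0 < w u₀ / -c u₀ := div_pos (hpos u₀ hu₀) (neg_pos.2 hu₀)
  refine ⟨w u₀ / -c u₀, ht, fun u => ?_, ?_, fun hsub => ?_⟩
  · simp only [Pi.zero_apply, Pi.add_apply, Pi.smul_apply, smul_eq_mul]
    rcases lt_or_ge (c u) 0 with hu | hu
    · have := mul_le_mul_of_nonneg_right (hmin u hu) (neg_pos.2 hu).le
      rw [div_mul_cancel₀ _ (neg_pos.2 hu).ne'] at this
      linarith
    · exact add_nonneg (hw u) (mul_nonneg ht.le hu)
  · intro u hu hu'
    exact hu (by simp [hu', hc u hu'])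
  · refine hsub (show u₀ ∈ Function.support w from (hpos u₀ hu₀).ne') ?_
    have := hu₀.ne
    simp only [Pi.add_apply, Pi.smul_apply, smul_eq_mul]
    field_simp
    ring

/-- Nonnegative weights on vectors are a convex combination of nonnegative weights that have the
same weighted sum and a linearly independent support, provided that the vectors lie in an open
half-space. -/
theorem mem_convexHull_linearIndepOn_support (v : U → V) (φ : V →ₗ[ℝ] ℝ) (w : U → ℝ)
    (hw : 0 ≤ w) (hφ : ∀ u, w u ≠ 0 → 0 < φ (v u)) :
    w ∈ convexHull ℝ {w' : U → ℝ | 0 ≤ w' ∧ ∑ u, w' u • v u = ∑ u, w u • v u ∧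
      LinearIndepOn ℝ v (Function.support w')} := by
  classical
  induction hn : (Function.support w).ncard using Nat.strong_induction_on generalizing w with
  | _ n ih =>
  by_cases hli : LinearIndepOn ℝ v (Function.support w)
  · exact subset_convexHull ℝ _ ⟨hw, rfl, hli⟩
  obtain ⟨c, hcs, hc0, hcne⟩ := linearDepOn_iff.1 hli
  have hsum : ∑ u, c u • v u = 0 := by
    rw [← hc0]
    exact (Finset.sum_subset (Finset.subset_univ _) fun u _ hu => by
      simp [Finsupp.notMem_support_iff.1 hu]).symm
  have hcz : ∀ u, w u = 0 → c u = 0 := by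
    intro u hu
    by_contra h
    exact (Finsupp.mem_supported _ _).1 hcs (by simpa using h) hu
  -- As `φ` is positive on the vectors involved, this forces the nonzero relation `c` to have
  -- entries of both signs, so the support can be reduced in both directions.
  have hφsum : ∑ u, c u * φ (v u) = 0 := by
    simpa using congrArg φ hsum
  have hterm : ∀ u, c u ≠ 0 → 0 < φ (v u) := fun u hu => hφ u fun h => hu (hcz u h)
  obtain ⟨u₁, hu₁⟩ := Finsupp.ne_iff.1 hcne
  have hne : ∀ u, c u * φ (v u) = 0 → c u = 0 := fun u h => by
    by_contra h'
    exact (mul_ne_zero h' (hterm u h').ne') h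
  have hneg : ∃ u, c u < 0 := by
    by_contra! h
    refine hu₁ (hne u₁ ((Finset.sum_eq_zero_iff_of_nonneg fun u _ => ?_).1 hφsum u₁
      (Finset.mem_univ _)))
    rcases (h u).eq_or_lt with h' | h'
    · simp [← h']
    · exact mul_nonneg h'.le (hterm u h'.ne').le
  have hpos : ∃ u, -c u < 0 := by
    by_contra! h
    refine hu₁ (hne u₁ ((Finset.sum_eq_zero_iff_of_nonpos fun u _ => ?_).1 hφsum u₁
      (Finset.mem_univ _)))
    rcases (h u).eq_or_lt with h' | h'
    · simp [neg_eq_zero.1 h'.symm]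
    · exact mul_nonpos_of_nonpos_of_nonneg (by linarith) (hterm u (by linarith)).le
  have step : ∀ d : U → ℝ, (∀ u, w u = 0 → d u = 0) → (∑ u, d u • v u = 0) → (∃ u, d u < 0) →
      ∃ t : ℝ, 0 < t ∧ w + t • d ∈ convexHull ℝ {w' : U → ℝ | 0 ≤ w' ∧
        ∑ u, w' u • v u = ∑ u, w u • v u ∧ LinearIndepOn ℝ v (Function.support w')} := by
    intro d hd hd0 hdneg
    obtain ⟨t, ht, hnn, hss⟩ := exists_pos_add_smul_support_ssubset hw hd hdneg
    refine ⟨t, ht, ?_⟩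
    have h := ih _ (hn ▸ Set.ncard_lt_ncard hss (Set.toFinite _)) (w + t • d) hnn
      (fun u hu => hφ u (hss.1 hu)) rfl
    have hs : ∑ u, (w + t • d) u • v u = ∑ u, w u • v u := by
      simp only [Pi.add_apply, Pi.smul_apply, add_smul, Finset.sum_add_distrib, smul_assoc,
        ← Finset.smul_sum, hd0, smul_zero, add_zero]
    rwa [hs] at h
  obtain ⟨s, hs, hsm⟩ := step c hcz hsum hneg
  obtain ⟨t, ht, htm⟩ := step (-c) (fun u hu => by simp [hcz u hu]) (by simp [hsum]) hpos
  have hst : 0 < s + t := add_pos hs ht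
  -- `w` lies on the segment from `w + s • c` to `w - t • c`, with weights t/(s+t) and s/(s+t).
  convert convex_convexHull ℝ _ hsm htm (div_pos ht hst).le (div_pos hs hst).le
    (by field_simp; ring) using 1
  funext u
  simp only [Pi.add_apply, Pi.smul_apply, Pi.neg_apply, smul_eq_mul]
  field_simp
  ring

end Caratheodory

/-! ### Shrinking the output alphabet of a channel. -/

section Channel

variable {α β E : Type*}

/-- A channel (stochastic matrix) from `α` to `β`. -/
def IsChannel [Fintype β] (W : α → β → ℝ) : Prop :=
  ∀ a, W a ∈ stdSimplex ℝ β

theorem sum_extend_columns [Fintype β] [AddCommMonoid E] (W : α → β → ℝ) {s : Set β}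
    (hs : ∀ a b, b ∉ s → W a b = 0) {N : ℕ} (e : s ↪ Fin N) {g : (α → ℝ) → E} (hg : g 0 = 0) :
    ∑ k, g (Function.extend e (fun (b : s) a => W a b) 0 k) = ∑ b, g (fun a => W a b) := by
  classical
  have h1 : ∑ k, g (Function.extend e (fun (b : s) a => W a b) 0 k) =
      ∑ b : s, g (fun a => W a b) := by
    refine (Fintype.sum_of_injective e e.injective _ _ (fun k hk => ?_) fun b => ?_).symm
    · rw [Function.extend_apply' _ _ _ (by simpa using hk)]
      exact hg
    · rw [e.injective.extend_apply]
  rw [h1]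
  refine Fintype.sum_of_injective _ Subtype.val_injective _ _ (fun b hb => ?_) fun b => rfl
  rw [← hg]
  congr 1
  funext a
  exact hs a b (by simpa using hb)

/-- The support of the output of a channel can be relabelled into a larger alphabet. -/
theorem IsChannel.exists_fin [Fintype β] [AddCommMonoid E] {W : α → β → ℝ} (hW : IsChannel W)
    {s : Set β} (hs : ∀ a b, b ∉ s → W a b = 0) {N : ℕ} (hN : s.ncard ≤ N) :
    ∃ W' : α → Fin N → ℝ, IsChannel W' ∧ ∀ g : (α → ℝ) → E, g 0 = 0 →
      ∑ k, g (fun a => W' a k) = ∑ b, g (fun a => W a b) := by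
  classical
  have hcard : Fintype.card s ≤ Fintype.card (Fin N) := by
    rwa [Fintype.card_fin, ← Nat.card_eq_fintype_card, Nat.card_coe_set_eq]
  obtain ⟨e⟩ := Function.Embedding.nonempty_of_card_le hcard
  refine ⟨fun a k => Function.extend e (fun (b : s) a => W a b) 0 k a, fun a => ⟨fun k => ?_, ?_⟩,
    fun g hg => sum_extend_columns W hs e hg⟩
  · by_cases hk : ∃ b, e b = k
    · obtain ⟨b, rfl⟩ := hk
      simpa only [e.injective.extend_apply] using (hW a).1 b
    · simp only [Function.extend_apply' _ _ _ hk, Pi.zero_apply, le_refl]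
  · exact (sum_extend_columns W hs e (g := fun w => w a) rfl).trans (hW a).2

theorem IsChannel.smul_columns [Fintype β] {W : α → β → ℝ} (hW : IsChannel W) {w : β → ℝ} (hw : 0 ≤ w)
    (h : ∀ a, ∑ b, w b * W a b = 1) : IsChannel fun a b => w b * W a b :=
  fun a => ⟨fun b => mul_nonneg (hw b) ((hW a).1 b), h a⟩

open Classical in
/-- The indicator of the outputs that a channel can produce. -/
noncomputable def outputIndicator (W : α → β → ℝ) (b : β) : ℝ :=
  if (fun a => W a b) = 0 then 0 else 1

theorem outputIndicator_nonneg (W : α → β → ℝ) : 0 ≤ outputIndicator W := fun b => by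
  unfold outputIndicator
  split_ifs <;> simp

/-- These weights act like all-ones weights, yet they skip zero columns, which would violate the
half-space condition of `mem_convexHull_linearIndepOn_support`. -/
theorem outputIndicator_smul [AddCommGroup E] [Module ℝ E] (W : α → β → ℝ) {g : (α → ℝ) → E}
    (hg : g 0 = 0) (b : β) :
    outputIndicator W b • g (fun a => W a b) = g (fun a => W a b) := by
  unfold outputIndicator
  split_ifs with h
  · rw [h, hg, smul_zero]
  · rw [one_smul]

theorem IsChannel.sum_column_pos [Fintype α] [Fintype β] {W : α → β → ℝ} (hW : IsChannel W) {b : β}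
    (h : outputIndicator W b ≠ 0) : 0 < ∑ a, W a b := by
  have hne : (fun a => W a b) ≠ 0 := fun h0 => h (by simp [outputIndicator, h0])
  obtain ⟨a, ha⟩ := Function.ne_iff.1 hne
  exact Finset.sum_pos' (fun a _ => (hW a).1 b) ⟨a, Finset.mem_univ _,
    ((hW a).1 b).lt_of_ne (Ne.symm ha)⟩

theorem ncard_support_le_finrank [Fintype β] {V : Type*} [AddCommGroup V] [Module ℝ V]
    [FiniteDimensional ℝ V] {v : β → V} {w : β → ℝ}
    (h : LinearIndepOn ℝ v (Function.support w)) :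
    (Function.support w).ncard ≤ Module.finrank ℝ V := by
  classical
  have := LinearIndependent.fintype_card_le_finrank h
  rwa [← Nat.card_eq_fintype_card, Nat.card_coe_set_eq] at this

variable [Fintype α] [Fintype β] [AddCommGroup E] [Module ℝ E]

/-- A sum of a homogeneous function over the columns of a channel is a convex combination of such
sums for channels with an output alphabet no larger than the input alphabet. -/
theorem IsChannel.sum_columns_mem_convexHull {W : α → β → ℝ} (hW : IsChannel W)
    {g : (α → ℝ) → E} (hg : ∀ (s : ℝ) w, g (s • w) = s • g w) :
    ∑ b, g (fun a => W a b) ∈ convexHull ℝ {x | ∃ W' : α → Fin (Fintype.card α) → ℝ,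
      IsChannel W' ∧ ∑ k, g (fun a => W' a k) = x} := by
  have hg0 : g 0 = 0 := by simpa using hg 0 0
  have h := mem_convexHull_linearIndepOn_support (fun b a => W a b)
    (∑ a, LinearMap.proj a) (outputIndicator W) (outputIndicator_nonneg W)
    fun b hb => by simpa using hW.sum_column_pos hb
  -- By homogeneity, reweighting the columns changes the sum of `g` linearly in the weights, so `L`
  -- carries the convex combination of weights to one of values.
  let L : (β → ℝ) →ₗ[ℝ] E :=
    ∑ b, (LinearMap.proj b : (β → ℝ) →ₗ[ℝ] ℝ).smulRight (g fun a => W a b)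
  have hL : ∀ w : β → ℝ, L w = ∑ b, w b • g fun a => W a b := fun w => by simp [L]
  have h2 := Set.mem_image_of_mem L h
  rw [L.image_convexHull, hL, Finset.sum_congr rfl fun b _ => outputIndicator_smul W hg0 b] at h2
  refine convexHull_mono ?_ h2
  rintro _ ⟨w, ⟨hw, hsum, hli⟩, rfl⟩
  have hch : IsChannel fun a b => w b * W a b := hW.smul_columns hw fun a => by
    have h3 := congrFun hsum a
    have h4 := fun b => outputIndicator_smul W (g := fun w => w a) rfl b
    simp only [Finset.sum_apply, Pi.smul_apply, h4] at h3
    simpa [(hW a).2] using h3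
  obtain ⟨W', hW', hs⟩ := hch.exists_fin (E := E) (s := Function.support w)
    (fun a b hb => by simp [Function.notMem_support.1 hb])
    ((ncard_support_le_finrank hli).trans_eq (Module.finrank_fintype_fun_eq_card ℝ))
  refine ⟨W', hW', ?_⟩
  rw [hs g hg0, hL]
  exact Finset.sum_congr rfl fun b _ => hg (w b) _

/-- Any sum of a homogeneous function over the columns of a channel is attained by a channel with
an output alphabet of bounded size. -/
theorem IsChannel.exists_sum_columns_eq [FiniteDimensional ℝ E] {W : α → β → ℝ}
    (hW : IsChannel W) {g : (α → ℝ) → E} (hg : ∀ (s : ℝ) w, g (s • w) = s • g w) :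
    ∃ W' : α → Fin (Fintype.card α + Module.finrank ℝ E) → ℝ,
      IsChannel W' ∧ ∑ k, g (fun a => W' a k) = ∑ b, g (fun a => W a b) := by
  have hg0 : g 0 = 0 := by simpa using hg 0 0
  -- Pairing each column with its `g`-value makes every reduced weighting preserve the sum of `g`,
  -- so a single one suffices; the ambient dimension grows by that of `E`.
  have h := mem_convexHull_linearIndepOn_support
    (fun b => ((fun a => W a b, g fun a => W a b) : (α → ℝ) × E))
    ((∑ a, LinearMap.proj a) ∘ₗ LinearMap.fst ℝ (α → ℝ) E)
    (outputIndicator W) (outputIndicator_nonneg W)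
    fun b hb => by simpa using hW.sum_column_pos hb
  obtain ⟨w, hw, hsum, hli⟩ := convexHull_nonempty_iff.1 ⟨_, h⟩
  have h1 := congrArg Prod.fst hsum
  have h2 := congrArg Prod.snd hsum
  simp only [Prod.fst_sum, Prod.snd_sum, Prod.smul_mk] at h1 h2
  rw [Finset.sum_congr rfl fun b _ => outputIndicator_smul W hg0 b] at h2
  have hch : IsChannel fun a b => w b * W a b := hW.smul_columns hw fun a => by
    have h3 := congrFun h1 a
    have h4 := fun b => outputIndicator_smul W (g := fun w => w a) rfl b
    simp only [Finset.sum_apply, Pi.smul_apply, h4] at h3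
    simpa [(hW a).2] using h3
  obtain ⟨W', hW', hs⟩ := hch.exists_fin (E := E) (s := Function.support w)
    (fun a b hb => by simp [Function.notMem_support.1 hb])
    ((ncard_support_le_finrank hli).trans_eq
      (by rw [Module.finrank_prod, Module.finrank_fintype_fun_eq_card]))
  refine ⟨W', hW', ?_⟩
  rw [hs g hg0, ← h2]
  exact Finset.sum_congr rfl fun b _ => hg (w b) _

end Channel

/-! ### Joint laws built from a pair of channels. -/

section AuxiliaryLaw

variable {𝒳 𝒴₁ 𝒴₂ 𝒰₁ 𝒰₂ : Type*}

/-- The joint pmf `p(x, y₁, y₂) p(u₁ | y₁) p(u₂ | y₂)`. -/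
def auxLaw (P : 𝒳 × 𝒴₁ × 𝒴₂ → ℝ) (W₁ : 𝒴₁ → 𝒰₁ → ℝ) (W₂ : 𝒴₂ → 𝒰₂ → ℝ)
    (ω : 𝒳 × 𝒴₁ × 𝒴₂ × 𝒰₁ × 𝒰₂) : ℝ :=
  P (rvX ω, rvY₁ ω, rvY₂ ω) * W₁ (rvY₁ ω) (rvU₁ ω) * W₂ (rvY₂ ω) (rvU₂ ω)

theorem timeSharingLaw_mk {𝒬 : Type*} (P : 𝒳 × 𝒴₁ × 𝒴₂ → ℝ) (pQ : 𝒬 → ℝ)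
    (W₁ : 𝒬 → 𝒴₁ → 𝒰₁ → ℝ) (W₂ : 𝒬 → 𝒴₂ → 𝒰₂ → ℝ) (q : 𝒬) (ω : 𝒳 × 𝒴₁ × 𝒴₂ × 𝒰₁ × 𝒰₂) :
    timeSharingLaw P pQ W₁ W₂ (q, ω) = pQ q * auxLaw P (W₁ q) (W₂ q) ω := by
  simp only [timeSharingLaw, auxLaw, mul_assoc]

variable [Fintype 𝒳] [Fintype 𝒴₁] [Fintype 𝒴₂] [Fintype 𝒰₁] [Fintype 𝒰₂]
  {P : 𝒳 × 𝒴₁ × 𝒴₂ → ℝ} {W₁ : 𝒴₁ → 𝒰₁ → ℝ} {W₂ : 𝒴₂ → 𝒰₂ → ℝ}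

theorem auxLaw_mem_stdSimplex (hP : P ∈ stdSimplex ℝ (𝒳 × 𝒴₁ × 𝒴₂)) (hW₁ : IsChannel W₁)
    (hW₂ : IsChannel W₂) : auxLaw P W₁ W₂ ∈ stdSimplex ℝ (𝒳 × 𝒴₁ × 𝒴₂ × 𝒰₁ × 𝒰₂) := by
  refine ⟨fun ω => mul_nonneg (mul_nonneg (hP.1 _) ((hW₁ _).1 _)) ((hW₂ _).1 _), ?_⟩
  have := hP.2
  simp only [Fintype.sum_prod_type] at this
  simp only [auxLaw, rvX, rvY₁, rvY₂, rvU₁, rvU₂, Fintype.sum_prod_type, ← Finset.mul_sum,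
    (hW₁ _).2, (hW₂ _).2, mul_one, this]

theorem auxLaw_kernel₁ (hW₁ : IsChannel W₁) (u₁ : 𝒰₁) (b : 𝒴₁ × 𝒰₂) :
    prob (auxLaw P W₁ W₂) (fun ω => (rvU₁ ω, rvY₁ ω, rvU₂ ω)) (u₁, b) =
      prob (auxLaw P W₁ W₂) (fun ω => (rvY₁ ω, rvU₂ ω)) b * W₁ b.1 u₁ := by
  classical
  obtain ⟨y₁, u₂⟩ := b
  simp only [prob_eq_sum_ite, Fintype.sum_prod_type, Prod.mk.injEq, ite_and, auxLaw,
    rvX, rvY₁, rvY₂, rvU₁, rvU₂]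
  simp [Finset.sum_ite_irrel, ← Finset.sum_mul, ← Finset.mul_sum, (hW₁ _).2]
  simp only [Finset.sum_mul, mul_right_comm]

theorem auxLaw_kernel₂ (hW₂ : IsChannel W₂) (u₂ : 𝒰₂) (b : 𝒴₂ × 𝒰₁) :
    prob (auxLaw P W₁ W₂) (fun ω => (rvU₂ ω, rvY₂ ω, rvU₁ ω)) (u₂, b) =
      prob (auxLaw P W₁ W₂) (fun ω => (rvY₂ ω, rvU₁ ω)) b * W₂ b.1 u₂ := by
  classical
  obtain ⟨y₁, u₂⟩ := b
  simp only [prob_eq_sum_ite, Fintype.sum_prod_type, Prod.mk.injEq, ite_and, auxLaw,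
    rvX, rvY₁, rvY₂, rvU₁, rvU₂]
  simp [Finset.sum_ite_irrel, ← Finset.sum_mul, ← Finset.mul_sum, (hW₂ _).2]

theorem auxLaw_kernel (hW₁ : IsChannel W₁) (hW₂ : IsChannel W₂) (a : 𝒰₁ × 𝒰₂) (b : 𝒴₁ × 𝒴₂) :
    prob (auxLaw P W₁ W₂) (fun ω => ((rvU₁ ω, rvU₂ ω), (rvY₁ ω, rvY₂ ω))) (a, b) =
      prob (auxLaw P W₁ W₂) (fun ω => (rvY₁ ω, rvY₂ ω)) b * (W₁ b.1 a.1 * W₂ b.2 a.2) := by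
  classical
  obtain ⟨u₁, u₂⟩ := a
  obtain ⟨y₁, y₂⟩ := b
  simp only [prob_eq_sum_ite, Fintype.sum_prod_type, Prod.mk.injEq, ite_and, auxLaw,
    rvX, rvY₁, rvY₂, rvU₁, rvU₂]
  simp [Finset.sum_ite_irrel, ← Finset.sum_mul, ← Finset.mul_sum, (hW₁ _).2, (hW₂ _).2]
  rw [mul_assoc]

end AuxiliaryLaw

/-! ### The information vector as a sum over columns. -/

section Mass

variable {𝒳 𝒴₁ 𝒴₂ 𝒰₁ 𝒰₂ : Type*} [Fintype 𝒴₁] [Fintype 𝒴₂]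

/-- The probability of `X = x`, `U₁ = u₁` and `U₂ = u₂`, where `w₁` and `w₂` are the columns of
`u₁` and `u₂` in the channels. -/
def massX (P : 𝒳 × 𝒴₁ × 𝒴₂ → ℝ) (x : 𝒳) (w₁ : 𝒴₁ → ℝ) (w₂ : 𝒴₂ → ℝ) : ℝ :=
  ∑ y₁, ∑ y₂, P (x, y₁, y₂) * w₁ y₁ * w₂ y₂

/-- The probability of `U₁ = u₁` and `U₂ = u₂`, where `w₁` and `w₂` are the columns of `u₁` and
`u₂` in the channels. -/
def mass [Fintype 𝒳] (P : 𝒳 × 𝒴₁ × 𝒴₂ → ℝ) (w₁ : 𝒴₁ → ℝ) (w₂ : 𝒴₂ → ℝ) : ℝ :=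
  ∑ x, massX P x w₁ w₂

variable (P : 𝒳 × 𝒴₁ × 𝒴₂ → ℝ)

theorem massX_smul_left (x : 𝒳) (s : ℝ) (w₁ : 𝒴₁ → ℝ) (w₂ : 𝒴₂ → ℝ) :
    massX P x (s • w₁) w₂ = s * massX P x w₁ w₂ := by
  simp only [massX, Finset.mul_sum, Pi.smul_apply, smul_eq_mul]
  exact Finset.sum_congr rfl fun _ _ => Finset.sum_congr rfl fun _ _ => by ring

theorem massX_smul_right (x : 𝒳) (s : ℝ) (w₁ : 𝒴₁ → ℝ) (w₂ : 𝒴₂ → ℝ) :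
    massX P x w₁ (s • w₂) = s * massX P x w₁ w₂ := by
  simp only [massX, Finset.mul_sum, Pi.smul_apply, smul_eq_mul]
  exact Finset.sum_congr rfl fun _ _ => Finset.sum_congr rfl fun _ _ => by ring

variable [Fintype 𝒳] [Fintype 𝒰₁] [Fintype 𝒰₂]

theorem mass_eq_sum (w₁ : 𝒴₁ → ℝ) (w₂ : 𝒴₂ → ℝ) :
    mass P w₁ w₂ = ∑ x, ∑ y₁, ∑ y₂, P (x, y₁, y₂) * w₁ y₁ * w₂ y₂ := rfl

theorem mass_smul_left (s : ℝ) (w₁ : 𝒴₁ → ℝ) (w₂ : 𝒴₂ → ℝ) :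
    mass P (s • w₁) w₂ = s * mass P w₁ w₂ := by
  simp only [mass, massX_smul_left, Finset.mul_sum]

theorem mass_smul_right (s : ℝ) (w₁ : 𝒴₁ → ℝ) (w₂ : 𝒴₂ → ℝ) :
    mass P w₁ (s • w₂) = s * mass P w₁ w₂ := by
  simp only [mass, massX_smul_right, Finset.mul_sum]

theorem mass_add_left (v w : 𝒴₁ → ℝ) (w₂ : 𝒴₂ → ℝ) :
    mass P (v + w) w₂ = mass P v w₂ + mass P w w₂ := by
  simp only [mass_eq_sum, ← Finset.sum_add_distrib, Pi.add_apply, mul_add, add_mul]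

theorem mass_add_right (w₁ : 𝒴₁ → ℝ) (v w : 𝒴₂ → ℝ) :
    mass P w₁ (v + w) = mass P w₁ v + mass P w₁ w := by
  simp only [mass_eq_sum, ← Finset.sum_add_distrib, Pi.add_apply, mul_add]

variable {P}

theorem sum_mass_right {W₂ : 𝒴₂ → 𝒰₂ → ℝ} (hW₂ : IsChannel W₂) (w₁ : 𝒴₁ → ℝ) :
    ∑ u₂, mass P w₁ (fun y => W₂ y u₂) = mass P w₁ 1 := by
  simp only [mass_eq_sum, Finset.sum_comm (s := (Finset.univ : Finset 𝒰₂)), ← Finset.mul_sum,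
    (hW₂ _).2, Pi.one_apply]

theorem sum_mass_left {W₁ : 𝒴₁ → 𝒰₁ → ℝ} (hW₁ : IsChannel W₁) (w₂ : 𝒴₂ → ℝ) :
    ∑ u₁, mass P (fun y => W₁ y u₁) w₂ = mass P 1 w₂ := by
  simp only [mass_eq_sum, Finset.sum_comm (s := (Finset.univ : Finset 𝒰₁)), ← Finset.sum_mul,
    ← Finset.mul_sum, (hW₁ _).2, Pi.one_apply]

variable (P)

theorem mass_one_one (hP : P ∈ stdSimplex ℝ (𝒳 × 𝒴₁ × 𝒴₂)) : mass P 1 1 = 1 := by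
  rw [← hP.2]
  simp [mass_eq_sum, Fintype.sum_prod_type]

theorem mass_negMulLog_smul_left (s : ℝ) (w₁ : 𝒴₁ → ℝ) (w₂ : 𝒴₂ → ℝ) :
    mass P (fun y => Real.negMulLog ((s • w₁) y)) w₂ =
      Real.negMulLog s * mass P w₁ w₂ + s * mass P (fun y => Real.negMulLog (w₁ y)) w₂ := by
  rw [← mass_smul_left, ← mass_smul_left, ← mass_add_left]
  congr 1
  funext y
  simp [Real.negMulLog_mul, mul_comm]

theorem mass_negMulLog_smul_right (s : ℝ) (w₁ : 𝒴₁ → ℝ) (w₂ : 𝒴₂ → ℝ) :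
    mass P w₁ (fun y => Real.negMulLog ((s • w₂) y)) =
      Real.negMulLog s * mass P w₁ w₂ + s * mass P w₁ (fun y => Real.negMulLog (w₂ y)) := by
  rw [← mass_smul_right, ← mass_smul_right, ← mass_add_right]
  congr 1
  funext y
  simp [Real.negMulLog_mul, mul_comm]

/-- The vector `(I(U₁, U₂; Y₁, Y₂), I(U₁; Y₁), I(U₂; Y₂), H(X | U₁, U₂))`, written in terms of the
columns of the channels. -/
noncomputable def infoVector (W₁ : 𝒴₁ → 𝒰₁ → ℝ) (W₂ : 𝒴₂ → 𝒰₂ → ℝ) : ℝ × ℝ × ℝ × ℝ :=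
  (∑ u₁, ∑ u₂, Real.negMulLog (mass P (fun y => W₁ y u₁) (fun y => W₂ y u₂)) -
      ∑ u₁, mass P (fun y => Real.negMulLog (W₁ y u₁)) 1 -
      ∑ u₂, mass P 1 (fun y => Real.negMulLog (W₂ y u₂)),
    ∑ u₁, (Real.negMulLog (mass P (fun y => W₁ y u₁) 1) -
      mass P (fun y => Real.negMulLog (W₁ y u₁)) 1),
    ∑ u₂, (Real.negMulLog (mass P 1 (fun y => W₂ y u₂)) -
      mass P 1 (fun y => Real.negMulLog (W₂ y u₂))),
    ∑ u₁, ∑ u₂, (∑ x, Real.negMulLog (massX P x (fun y => W₁ y u₁) (fun y => W₂ y u₂)) -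
      Real.negMulLog (mass P (fun y => W₁ y u₁) (fun y => W₂ y u₂))))

theorem continuous_infoVector :
    Continuous fun W : (𝒴₁ → 𝒰₁ → ℝ) × (𝒴₂ → 𝒰₂ → ℝ) => infoVector P W.1 W.2 := by
  unfold infoVector mass massX
  fun_prop

/-- The contribution of a column of the first channel to `infoVector`. -/
noncomputable def columnInfo₁ (W₂ : 𝒴₂ → 𝒰₂ → ℝ) (w : 𝒴₁ → ℝ) : ℝ × ℝ × ℝ × ℝ :=
  (∑ u₂, Real.negMulLog (mass P w (fun y => W₂ y u₂)) -
      mass P (fun y => Real.negMulLog (w y)) 1 -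
      ∑ u₂, mass P w (fun y => Real.negMulLog (W₂ y u₂)),
    Real.negMulLog (mass P w 1) - mass P (fun y => Real.negMulLog (w y)) 1,
    mass P w 1 * ∑ u₂, (Real.negMulLog (mass P 1 (fun y => W₂ y u₂)) -
      mass P 1 (fun y => Real.negMulLog (W₂ y u₂))),
    ∑ u₂, (∑ x, Real.negMulLog (massX P x w (fun y => W₂ y u₂)) -
      Real.negMulLog (mass P w (fun y => W₂ y u₂))))

/-- The contribution of a column of the second channel to `infoVector`. -/
noncomputable def columnInfo₂ (W₁ : 𝒴₁ → 𝒰₁ → ℝ) (w : 𝒴₂ → ℝ) : ℝ × ℝ × ℝ × ℝ :=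
  (∑ u₁, Real.negMulLog (mass P (fun y => W₁ y u₁) w) -
      ∑ u₁, mass P (fun y => Real.negMulLog (W₁ y u₁)) w -
      mass P 1 (fun y => Real.negMulLog (w y)),
    mass P 1 w * ∑ u₁, (Real.negMulLog (mass P (fun y => W₁ y u₁) 1) -
      mass P (fun y => Real.negMulLog (W₁ y u₁)) 1),
    Real.negMulLog (mass P 1 w) - mass P 1 (fun y => Real.negMulLog (w y)),
    ∑ u₁, (∑ x, Real.negMulLog (massX P x (fun y => W₁ y u₁) w) -
      Real.negMulLog (mass P (fun y => W₁ y u₁) w)))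

variable {P}

/-- I(U₂;Y₂) does not involve `W₁`; each column carries its share `mass P w 1` of it, and the shares
add up to 1. -/
theorem sum_columnInfo₁ (hP : P ∈ stdSimplex ℝ (𝒳 × 𝒴₁ × 𝒴₂)) {W₁ : 𝒴₁ → 𝒰₁ → ℝ}
    (hW₁ : IsChannel W₁) (W₂ : 𝒴₂ → 𝒰₂ → ℝ) :
    ∑ u₁, columnInfo₁ P W₂ (fun y => W₁ y u₁) = infoVector P W₁ W₂ := by
  simp only [columnInfo₁, infoVector, Prod.ext_iff, Prod.fst_sum, Prod.snd_sum, true_and, and_true]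
  refine ⟨?_, ?_⟩
  · simp only [Finset.sum_sub_distrib]
    rw [Finset.sum_comm (f := fun u₁ u₂ => mass P (fun y => W₁ y u₁)
      (fun y => Real.negMulLog (W₂ y u₂)))]
    simp only [sum_mass_left hW₁]
  · rw [← Finset.sum_mul, sum_mass_left hW₁, mass_one_one P hP, one_mul]

theorem sum_columnInfo₂ (hP : P ∈ stdSimplex ℝ (𝒳 × 𝒴₁ × 𝒴₂)) (W₁ : 𝒴₁ → 𝒰₁ → ℝ)
    {W₂ : 𝒴₂ → 𝒰₂ → ℝ} (hW₂ : IsChannel W₂) :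
    ∑ u₂, columnInfo₂ P W₁ (fun y => W₂ y u₂) = infoVector P W₁ W₂ := by
  simp only [columnInfo₂, infoVector, Prod.ext_iff, Prod.fst_sum, Prod.snd_sum, true_and]
  refine ⟨?_, ?_, ?_⟩
  · simp only [Finset.sum_sub_distrib]
    rw [Finset.sum_comm, Finset.sum_comm (f := fun u₂ u₁ => mass P
      (fun y => Real.negMulLog (W₁ y u₁)) (fun y => W₂ y u₂))]
    simp only [sum_mass_right hW₂]
  · rw [← Finset.sum_mul, sum_mass_right hW₂, mass_one_one P hP, one_mul]
  · rw [Finset.sum_comm]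

/-- Each entropy term scales up to a defect `negMulLog s` times a mass. Since `W₂` is stochastic
these masses sum to `mass P w 1`, and the defects cancel in each component. -/
theorem columnInfo₁_smul {W₂ : 𝒴₂ → 𝒰₂ → ℝ} (hW₂ : IsChannel W₂) (s : ℝ) (w : 𝒴₁ → ℝ) :
    columnInfo₁ P W₂ (s • w) = s • columnInfo₁ P W₂ w := by
  simp only [columnInfo₁, mass_negMulLog_smul_left, mass_smul_left, massX_smul_left,
    Real.negMulLog_mul, Finset.sum_add_distrib, ← Finset.sum_mul, ← Finset.mul_sum,
    sum_mass_right hW₂, Prod.smul_mk, smul_eq_mul, Prod.mk.injEq, Finset.sum_sub_distrib]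
  refine ⟨by ring, by ring, by ring, ?_⟩
  have h := sum_mass_right (P := P) hW₂ w
  simp only [mass] at h ⊢
  rw [h]
  ring

theorem columnInfo₂_smul {W₁ : 𝒴₁ → 𝒰₁ → ℝ} (hW₁ : IsChannel W₁) (s : ℝ) (w : 𝒴₂ → ℝ) :
    columnInfo₂ P W₁ (s • w) = s • columnInfo₂ P W₁ w := by
  simp only [columnInfo₂, mass_negMulLog_smul_right, mass_smul_right, massX_smul_right,
    Real.negMulLog_mul, Finset.sum_add_distrib, ← Finset.sum_mul, ← Finset.mul_sum,
    sum_mass_left hW₁, Prod.smul_mk, smul_eq_mul, Prod.mk.injEq, Finset.sum_sub_distrib]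
  refine ⟨by ring, by ring, by ring, ?_⟩
  have h := sum_mass_left (P := P) hW₁ w
  simp only [mass] at h ⊢
  rw [h]
  ring

/-- Channels with output alphabets no larger than the input alphabets generate, by convex
combinations, all information vectors. -/
theorem infoVector_mem_convexHull (hP : P ∈ stdSimplex ℝ (𝒳 × 𝒴₁ × 𝒴₂)) {W₁ : 𝒴₁ → 𝒰₁ → ℝ}
    (hW₁ : IsChannel W₁) {W₂ : 𝒴₂ → 𝒰₂ → ℝ} (hW₂ : IsChannel W₂) :
    infoVector P W₁ W₂ ∈ convexHull ℝ {v | ∃ (V₁ : 𝒴₁ → Fin (Fintype.card 𝒴₁) → ℝ)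
      (V₂ : 𝒴₂ → Fin (Fintype.card 𝒴₂) → ℝ), IsChannel V₁ ∧ IsChannel V₂ ∧
        infoVector P V₁ V₂ = v} := by
  rw [← sum_columnInfo₁ hP hW₁]
  refine convexHull_min ?_ (convex_convexHull ℝ _)
    (hW₁.sum_columns_mem_convexHull (columnInfo₁_smul hW₂))
  -- The first channel is now small; it stays fixed while the second is reduced.
  rintro _ ⟨V₁, hV₁, rfl⟩
  rw [sum_columnInfo₁ hP hV₁, ← sum_columnInfo₂ hP _ hW₂]
  refine convexHull_mono ?_ (hW₂.sum_columns_mem_convexHull (columnInfo₂_smul hV₁))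
  rintro _ ⟨V₂, hV₂, rfl⟩
  exact ⟨V₁, V₂, hV₁, hV₂, (sum_columnInfo₂ hP _ hV₂).symm⟩

/-- Channels with output alphabets of bounded size attain all information vectors. -/
theorem exists_infoVector_eq (hP : P ∈ stdSimplex ℝ (𝒳 × 𝒴₁ × 𝒴₂)) {W₁ : 𝒴₁ → 𝒰₁ → ℝ}
    (hW₁ : IsChannel W₁) {W₂ : 𝒴₂ → 𝒰₂ → ℝ} (hW₂ : IsChannel W₂) :
    ∃ (V₁ : 𝒴₁ → Fin (Fintype.card 𝒴₁ + Module.finrank ℝ (ℝ × ℝ × ℝ × ℝ)) → ℝ)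
      (V₂ : 𝒴₂ → Fin (Fintype.card 𝒴₂ + Module.finrank ℝ (ℝ × ℝ × ℝ × ℝ)) → ℝ),
      IsChannel V₁ ∧ IsChannel V₂ ∧ infoVector P V₁ V₂ = infoVector P W₁ W₂ := by
  obtain ⟨V₁, hV₁, h₁⟩ := hW₁.exists_sum_columns_eq (columnInfo₁_smul (P := P) hW₂)
  obtain ⟨V₂, hV₂, h₂⟩ := hW₂.exists_sum_columns_eq (columnInfo₂_smul (P := P) hV₁)
  rw [sum_columnInfo₁ hP hV₁, sum_columnInfo₁ hP hW₁] at h₁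
  rw [sum_columnInfo₂ hP _ hV₂, sum_columnInfo₂ hP _ hW₂] at h₂
  exact ⟨V₁, V₂, hV₁, hV₂, h₂.trans h₁⟩

end Mass

/-! ### Identifying the information quantities of a channel pair. -/

section Marginals

variable {𝒳 𝒴₁ 𝒴₂ 𝒰₁ 𝒰₂ : Type*} [Fintype 𝒳] [Fintype 𝒴₁] [Fintype 𝒴₂] [Fintype 𝒰₁] [Fintype 𝒰₂]
  {P : 𝒳 × 𝒴₁ × 𝒴₂ → ℝ} {W₁ : 𝒴₁ → 𝒰₁ → ℝ} {W₂ : 𝒴₂ → 𝒰₂ → ℝ}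

theorem prob_auxLaw_XU (x : 𝒳) (u₁ : 𝒰₁) (u₂ : 𝒰₂) :
    prob (auxLaw P W₁ W₂) (fun ω => (rvX ω, rvU₁ ω, rvU₂ ω)) (x, u₁, u₂) =
      massX P x (fun y => W₁ y u₁) (fun y => W₂ y u₂) := by
  classical
  simp only [prob_eq_sum_ite, Fintype.sum_prod_type, Prod.mk.injEq, ite_and, auxLaw, massX,
    rvX, rvY₁, rvY₂, rvU₁, rvU₂]
  simp [Finset.sum_ite_irrel]

theorem prob_auxLaw_U (u₁ : 𝒰₁) (u₂ : 𝒰₂) :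
    prob (auxLaw P W₁ W₂) (fun ω => (rvU₁ ω, rvU₂ ω)) (u₁, u₂) =
      mass P (fun y => W₁ y u₁) (fun y => W₂ y u₂) := by
  rw [← sum_prob_prodMk_left _ rvX, mass]
  simp only [prob_auxLaw_XU]

theorem prob_auxLaw_U₁ (hW₂ : IsChannel W₂) (u₁ : 𝒰₁) :
    prob (auxLaw P W₁ W₂) rvU₁ u₁ = mass P (fun y => W₁ y u₁) 1 := by
  rw [← sum_prob_prodMk_right _ _ rvU₂, ← sum_mass_right hW₂]
  simp only [prob_auxLaw_U]

theorem prob_auxLaw_U₂ (hW₁ : IsChannel W₁) (u₂ : 𝒰₂) :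
    prob (auxLaw P W₁ W₂) rvU₂ u₂ = mass P 1 (fun y => W₂ y u₂) := by
  rw [← sum_prob_prodMk_left _ rvU₁, ← sum_mass_left hW₁]
  simp only [prob_auxLaw_U]

theorem sum_auxLaw_mul (hW₁ : IsChannel W₁) (hW₂ : IsChannel W₂) (F : 𝒴₁ → 𝒴₂ → ℝ) :
    ∑ ω, auxLaw P W₁ W₂ ω * F (rvY₁ ω) (rvY₂ ω) =
      ∑ x, ∑ y₁, ∑ y₂, P (x, y₁, y₂) * F y₁ y₂ := by
  simp only [auxLaw, Fintype.sum_prod_type, rvX, rvY₁, rvY₂, rvU₁, rvU₂, ← Finset.sum_mul,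
    ← Finset.mul_sum, (hW₁ _).2, (hW₂ _).2, mul_one]

theorem sum_auxLaw_mul_entropy₁ (hW₁ : IsChannel W₁) (hW₂ : IsChannel W₂) :
    ∑ ω, auxLaw P W₁ W₂ ω * ∑ u₁, Real.negMulLog (W₁ (rvY₁ ω) u₁) =
      ∑ u₁, mass P (fun y => Real.negMulLog (W₁ y u₁)) 1 := by
  rw [sum_auxLaw_mul hW₁ hW₂ fun y₁ _ => ∑ u₁, Real.negMulLog (W₁ y₁ u₁)]
  simp only [mass_eq_sum, Finset.sum_comm (s := (Finset.univ : Finset 𝒰₁)), Finset.mul_sum,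
    Pi.one_apply, mul_one]

theorem sum_auxLaw_mul_entropy₂ (hW₁ : IsChannel W₁) (hW₂ : IsChannel W₂) :
    ∑ ω, auxLaw P W₁ W₂ ω * ∑ u₂, Real.negMulLog (W₂ (rvY₂ ω) u₂) =
      ∑ u₂, mass P 1 (fun y => Real.negMulLog (W₂ y u₂)) := by
  rw [sum_auxLaw_mul hW₁ hW₂ fun _ y₂ => ∑ u₂, Real.negMulLog (W₂ y₂ u₂)]
  simp only [mass_eq_sum, Finset.sum_comm (s := (Finset.univ : Finset 𝒰₂)), Finset.mul_sum,
    Pi.one_apply, mul_one]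

section InfoVector

variable (hP : P ∈ stdSimplex ℝ (𝒳 × 𝒴₁ × 𝒴₂)) (hW₁ : IsChannel W₁) (hW₂ : IsChannel W₂)
include hP hW₁ hW₂

theorem condEntropy_auxLaw_X :
    condEntropy (auxLaw P W₁ W₂) rvX (fun ω => (rvU₁ ω, rvU₂ ω)) =
      (infoVector P W₁ W₂).2.2.2 := by
  rw [condEntropy_eq_entropy_sub (auxLaw_mem_stdSimplex hP hW₁ hW₂).1]
  simp only [entropy, infoVector, Fintype.sum_prod_type, prob_auxLaw_XU, prob_auxLaw_U,
    Finset.sum_sub_distrib]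
  rw [Finset.sum_comm]
  simp only [Finset.sum_comm (s := (Finset.univ : Finset 𝒳))]

theorem mutualInfo_auxLaw₁ :
    mutualInfo (auxLaw P W₁ W₂) rvY₁ rvU₁ = (infoVector P W₁ W₂).2.1 := by
  have h0 := (auxLaw_mem_stdSimplex hP hW₁ hW₂).1
  rw [mutualInfo_comm h0, mutualInfo, condEntropy_of_kernel h0 (fun y => (hW₁ y).2),
    sum_auxLaw_mul_entropy₁ hW₁ hW₂]
  · simp only [entropy, infoVector, prob_auxLaw_U₁ hW₂, Finset.sum_sub_distrib]
  · intro u y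
    have := fun u₂ => auxLaw_kernel₁ (P := P) (W₂ := W₂) hW₁ u (y, u₂)
    rw [← sum_prob_prodMk_right _ rvY₁ rvU₂, Finset.sum_mul, ← Finset.sum_congr rfl
      fun u₂ _ => this u₂, ← sum_prob_prodMk_right _ _ rvU₂]
    refine Finset.sum_congr rfl fun u₂ _ => ?_
    exact (prob_equiv_comp _ _ (Equiv.prodAssoc 𝒰₁ 𝒴₁ 𝒰₂) ((u, y), u₂)).symm

theorem mutualInfo_auxLaw₂ :
    mutualInfo (auxLaw P W₁ W₂) rvY₂ rvU₂ = (infoVector P W₁ W₂).2.2.1 := by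
  have h0 := (auxLaw_mem_stdSimplex hP hW₁ hW₂).1
  rw [mutualInfo_comm h0, mutualInfo, condEntropy_of_kernel h0 (fun y => (hW₂ y).2),
    sum_auxLaw_mul_entropy₂ hW₁ hW₂]
  · simp only [entropy, infoVector, prob_auxLaw_U₂ hW₁, Finset.sum_sub_distrib]
  · intro u y
    have := fun u₁ => auxLaw_kernel₂ (P := P) (W₁ := W₁) hW₂ u (y, u₁)
    rw [← sum_prob_prodMk_right _ rvY₂ rvU₁, Finset.sum_mul, ← Finset.sum_congr rfl
      fun u₁ _ => this u₁, ← sum_prob_prodMk_right _ _ rvU₁]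
    refine Finset.sum_congr rfl fun u₁ _ => ?_
    exact (prob_equiv_comp _ _ (Equiv.prodAssoc 𝒰₂ 𝒴₂ 𝒰₁) ((u, y), u₁)).symm

theorem mutualInfo_auxLaw :
    mutualInfo (auxLaw P W₁ W₂) (fun ω => (rvU₁ ω, rvU₂ ω)) (fun ω => (rvY₁ ω, rvY₂ ω)) =
      (infoVector P W₁ W₂).1 := by
  have hK : ∀ y : 𝒴₁ × 𝒴₂, ∑ u : 𝒰₁ × 𝒰₂, W₁ y.1 u.1 * W₂ y.2 u.2 = 1 := fun y => by
    simp only [Fintype.sum_prod_type, ← Finset.mul_sum, (hW₁ _).2, (hW₂ _).2, mul_one]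
  rw [mutualInfo, condEntropy_of_kernel (auxLaw_mem_stdSimplex hP hW₁ hW₂).1 hK
    (auxLaw_kernel hW₁ hW₂)]
  simp only [Real.negMulLog_mul, Finset.sum_add_distrib, Fintype.sum_prod_type (α₁ := 𝒰₁),
    ← Finset.mul_sum, ← Finset.sum_mul, (hW₁ _).2, (hW₂ _).2, one_mul, mul_add,
    sum_auxLaw_mul_entropy₁ hW₁ hW₂, sum_auxLaw_mul_entropy₂ hW₁ hW₂]
  simp only [entropy, infoVector, prob_auxLaw_U, Fintype.sum_prod_type]
  ring

/-- Since `W₁` sees only Y₁, H(U₁|Y₁,U₂) = H(U₁|Y₁); the value is therefore H(U₁,U₂) - H(U₂) -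
H(U₁|Y₁), and H(U₂|Y₂) cancels in the difference on the right. -/
theorem condMutualInfo_auxLaw₁ :
    condMutualInfo (auxLaw P W₁ W₂) rvU₁ rvY₁ rvU₂ =
      (infoVector P W₁ W₂).1 - (infoVector P W₁ W₂).2.2.1 := by
  have h0 := (auxLaw_mem_stdSimplex hP hW₁ hW₂).1
  rw [condMutualInfo, condEntropy_of_kernel h0 (fun b : 𝒴₁ × 𝒰₂ => (hW₁ b.1).2)
    (auxLaw_kernel₁ hW₁), sum_auxLaw_mul_entropy₁ hW₁ hW₂, condEntropy_eq_entropy_sub h0]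
  simp only [entropy, infoVector, prob_auxLaw_U, prob_auxLaw_U₂ hW₁, Fintype.sum_prod_type,
    Finset.sum_sub_distrib]
  ring

theorem condMutualInfo_auxLaw₂ :
    condMutualInfo (auxLaw P W₁ W₂) rvU₂ rvY₂ rvU₁ =
      (infoVector P W₁ W₂).1 - (infoVector P W₁ W₂).2.1 := by
  have h0 := (auxLaw_mem_stdSimplex hP hW₁ hW₂).1
  rw [condMutualInfo, condEntropy_of_kernel h0 (fun b : 𝒴₂ × 𝒰₁ => (hW₂ b.1).2)
    (auxLaw_kernel₂ hW₂), sum_auxLaw_mul_entropy₂ hW₁ hW₂, condEntropy_eq_entropy_sub h0,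
    ← entropy_equiv_comp _ _ (Equiv.prodComm 𝒰₂ 𝒰₁)]
  simp only [entropy, infoVector, Equiv.prodComm_apply, Prod.swap_prod_mk, prob_auxLaw_U,
    prob_auxLaw_U₁ hW₂, Fintype.sum_prod_type, Finset.sum_sub_distrib]
  ring

/-- The gap between the two sides is I(U₁;U₂). -/
theorem infoVector_fst_le :
    (infoVector P W₁ W₂).1 ≤ (infoVector P W₁ W₂).2.1 + (infoVector P W₁ W₂).2.2.1 := by
  have h := entropy_prodMk_le (auxLaw_mem_stdSimplex hP hW₁ hW₂).1
    (auxLaw_mem_stdSimplex hP hW₁ hW₂).2 rvU₁ rvU₂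
  simp only [entropy, prob_auxLaw_U, prob_auxLaw_U₁ hW₂, prob_auxLaw_U₂ hW₁,
    Fintype.sum_prod_type] at h
  simp only [infoVector, Finset.sum_sub_distrib]
  linarith

end InfoVector
end Marginals
-- Conditional distributions and Markov chains.
section Kernel

variable {Ω α β γ : Type*} [Fintype Ω] {p : Ω → ℝ}

theorem prob_congr {f : Ω → α} {g : Ω → β} {a : α} {b : β} (h : ∀ ω, f ω = a ↔ g ω = b) :
    prob p f a = prob p g b := by
  classical
  simp only [prob_eq_sum_ite, h]

/-- Existence of the conditional distribution of `f` given `g`. -/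
theorem exists_kernel [Fintype α] [Nonempty α] (hp : 0 ≤ p) (f : Ω → α) (g : Ω → β) :
    ∃ K : β → α → ℝ, IsChannel K ∧
      ∀ a b, prob p (fun ω => (f ω, g ω)) (a, b) = prob p g b * K b a := by
  classical
  obtain ⟨a₀⟩ := ‹Nonempty α›
  -- On null events any distribution will do; a point mass keeps the kernel stochastic.
  refine ⟨fun b => if prob p g b = 0 then Pi.single a₀ 1 else
    fun a => prob p (fun ω => (f ω, g ω)) (a, b) / prob p g b, fun b => ?_, fun a b => ?_⟩
  · by_cases hb : prob p g b = 0
    · simpa only [hb, if_true] using single_mem_stdSimplex ℝ a₀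
    · simp only [hb, if_false]
      refine ⟨fun a => div_nonneg (prob_nonneg hp _ _) (prob_nonneg hp _ _), ?_⟩
      rw [← Finset.sum_div, sum_prob_prodMk_left, div_self hb]
  · by_cases hb : prob p g b = 0
    · rw [hb, zero_mul]
      exact le_antisymm (hb ▸ prob_le_prob_right hp f g a b) (prob_nonneg hp _ _)
    · simp only [hb, if_false]
      rw [mul_div_cancel₀ _ hb]

theorem MarkovChain.prob_eq_left [Fintype α] [Fintype γ] (hp : 0 ≤ p) {f : Ω → α} {g : Ω → β}
    {h : Ω → γ} (hm : MarkovChain p f g h) {K : β → α → ℝ}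
    (hK : ∀ a b, prob p (fun ω => (f ω, g ω)) (a, b) = prob p g b * K b a) (a : α) (b : β)
    (c : γ) :
    prob p (fun ω => (f ω, g ω, h ω)) (a, b, c) = K b a * prob p (fun ω => (g ω, h ω)) (b, c) := by
  rcases eq_or_ne (prob p g b) 0 with hb | hb
  · have h0 : prob p (fun ω => (g ω, h ω)) (b, c) = 0 := by
      refine le_antisymm ?_ (prob_nonneg hp _ _)
      rw [← hb, ← sum_prob_prodMk_right p g h b]
      exact Finset.single_le_sum (f := fun c => prob p (fun ω => (g ω, h ω)) (b, c))
        (fun c _ => prob_nonneg hp _ _) (Finset.mem_univ c)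
    rw [h0, mul_zero]
    exact le_antisymm (h0 ▸ prob_le_prob_right hp f (fun ω => (g ω, h ω)) a (b, c))
      (prob_nonneg hp _ _)
  · have := hm a b c
    rw [hK] at this
    exact mul_right_cancel₀ hb (by linarith)

theorem MarkovChain.symm {f : Ω → α} {g : Ω → β} {h : Ω → γ} (hm : MarkovChain p f g h) :
    MarkovChain p h g f := by
  intro c b a
  have e1 : prob p (fun ω => (h ω, g ω, f ω)) (c, b, a) =
      prob p (fun ω => (f ω, g ω, h ω)) (a, b, c) :=
    prob_congr fun ω => by simp only [Prod.mk.injEq]; tauto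
  have e2 : prob p (fun ω => (h ω, g ω)) (c, b) = prob p (fun ω => (g ω, h ω)) (b, c) :=
    prob_congr fun ω => by simp only [Prod.mk.injEq]; tauto
  have e3 : prob p (fun ω => (g ω, f ω)) (b, a) = prob p (fun ω => (f ω, g ω)) (a, b) :=
    prob_congr fun ω => by simp only [Prod.mk.injEq]; tauto
  rw [e1, e2, e3, hm a b c, mul_comm]

theorem prob_eq_apply {f : Ω → α} (hf : Function.Injective f) (ω : Ω) :
    prob p f (f ω) = p ω := by
  classical
  simp [prob_eq_sum_ite, hf.eq_iff]

end Kernel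

/-! ### Auxiliary laws are exactly the laws of channel pairs. -/

section AuxiliaryLaw

variable {𝒳 𝒴₁ 𝒴₂ 𝒰₁ 𝒰₂ : Type*} [Fintype 𝒳] [Fintype 𝒴₁] [Fintype 𝒴₂] [Fintype 𝒰₁] [Fintype 𝒰₂]
  {P : 𝒳 × 𝒴₁ × 𝒴₂ → ℝ}

theorem isAuxiliaryLaw_auxLaw (hP : IsSource P) {W₁ : 𝒴₁ → 𝒰₁ → ℝ} {W₂ : 𝒴₂ → 𝒰₂ → ℝ}
    (hW₁ : IsChannel W₁) (hW₂ : IsChannel W₂) : IsAuxiliaryLaw P (auxLaw P W₁ W₂) := by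
  classical
  refine ⟨auxLaw_mem_stdSimplex hP.pmf hW₁ hW₂, ?_, ?_, ?_, ?_⟩
  · rintro ⟨x, y₁, y₂⟩
    simp only [prob_eq_sum_ite, Fintype.sum_prod_type, Prod.mk.injEq, ite_and, auxLaw,
      rvX, rvY₁, rvY₂, rvU₁, rvU₂]
    simp [Finset.sum_ite_irrel, ← Finset.mul_sum, (hW₁ _).2, (hW₂ _).2]
  · rintro u₁ y₁ ⟨x, y₂, u₂⟩
    simp only [prob_eq_sum_ite, Fintype.sum_prod_type, Prod.mk.injEq, ite_and, auxLaw,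
      rvX, rvY₁, rvY₂, rvU₁, rvU₂]
    simp [Finset.sum_ite_irrel, ← Finset.mul_sum, ← Finset.sum_mul, (hW₁ _).2, (hW₂ _).2]
    ring
  · rintro ⟨u₁, y₁⟩ x ⟨y₂, u₂⟩
    have h := hP.markov y₁ x y₂
    have hX : prob P (fun ω => ω.1) x = ∑ y₁, ∑ y₂, P (x, y₁, y₂) := by
      simp only [prob_eq_sum_ite, Fintype.sum_prod_type]
      rw [Finset.sum_eq_single x] <;> simp +contextual
    have hYX : prob P (fun ω => (ω.2.1, ω.1)) (y₁, x) = ∑ y₂, P (x, y₁, y₂) := by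
      simp only [prob_eq_sum_ite, Fintype.sum_prod_type, Prod.mk.injEq, ite_and]
      rw [Finset.sum_eq_single x] <;> simp +contextual [Finset.sum_ite_irrel]
    rw [hX, hYX] at h
    simp only [prob_eq_sum_ite, Fintype.sum_prod_type, Prod.mk.injEq, ite_and, auxLaw,
      rvX, rvY₁, rvY₂, rvU₁, rvU₂] at h ⊢
    simp [Finset.sum_ite_irrel, ← Finset.mul_sum, ← Finset.sum_mul, (hW₁ _).2, (hW₂ _).2] at h ⊢
    linear_combination W₁ y₁ u₁ * W₂ y₂ u₂ * h
  · rintro ⟨u₁, y₁, x⟩ y₂ u₂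
    simp only [prob_eq_sum_ite, Fintype.sum_prod_type, Prod.mk.injEq, ite_and, auxLaw,
      rvX, rvY₁, rvY₂, rvU₁, rvU₂]
    simp [Finset.sum_ite_irrel, ← Finset.mul_sum, ← Finset.sum_mul, (hW₁ _).2, (hW₂ _).2]
    ring

/-- The chain `markov₁` splits off the factor of U₁ given Y₁, and `markov₃` that of U₂ given Y₂;
what remains is the marginal `P`. -/
theorem IsAuxiliaryLaw.exists_channels {μ : 𝒳 × 𝒴₁ × 𝒴₂ × 𝒰₁ × 𝒰₂ → ℝ}
    (hμ : IsAuxiliaryLaw P μ) :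
    ∃ (W₁ : 𝒴₁ → 𝒰₁ → ℝ) (W₂ : 𝒴₂ → 𝒰₂ → ℝ), IsChannel W₁ ∧ IsChannel W₂ ∧
      auxLaw P W₁ W₂ = μ := by
  have h0 := hμ.pmf.1
  obtain ⟨ω₀⟩ : Nonempty (𝒳 × 𝒴₁ × 𝒴₂ × 𝒰₁ × 𝒰₂) := by
    by_contra h
    rw [not_nonempty_iff] at h
    simpa using hμ.pmf.2
  have : Nonempty 𝒰₁ := ⟨rvU₁ ω₀⟩
  have : Nonempty 𝒰₂ := ⟨rvU₂ ω₀⟩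
  obtain ⟨W₁, hW₁, hK₁⟩ := exists_kernel h0 rvU₁ rvY₁
  obtain ⟨W₂, hW₂, hK₂⟩ := exists_kernel h0 rvU₂ rvY₂
  refine ⟨W₁, W₂, hW₁, hW₂, ?_⟩
  funext ⟨x, y₁, y₂, u₁, u₂⟩
  have h1 := hμ.markov₁.prob_eq_left h0 hK₁ u₁ y₁ (x, y₂, u₂)
  have h2 : prob μ (fun ω => (rvY₁ ω, rvX ω, rvY₂ ω, rvU₂ ω)) (y₁, x, y₂, u₂) =
      W₂ y₂ u₂ * P (x, y₁, y₂) := by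
    rw [← sum_prob_prodMk_left μ rvU₁, ← hμ.marginal, ← sum_prob_prodMk_left μ rvU₁,
      Finset.mul_sum]
    refine Finset.sum_congr rfl fun u _ => ?_
    have h3 := hμ.markov₃.symm.prob_eq_left h0 hK₂ u₂ y₂ (u, y₁, x)
    convert h3 using 2
    · exact prob_congr fun ω => by simp only [Prod.mk.injEq]; tauto
    · exact prob_congr fun ω => by simp only [Prod.mk.injEq]; tauto
  have h4 : prob μ (fun ω => (rvU₁ ω, rvY₁ ω, rvX ω, rvY₂ ω, rvU₂ ω)) (u₁, y₁, x, y₂, u₂) =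
      μ (x, y₁, y₂, u₁, u₂) := by
    refine prob_eq_apply (f := fun ω => (rvU₁ ω, rvY₁ ω, rvX ω, rvY₂ ω, rvU₂ ω)) ?_
      (x, y₁, y₂, u₁, u₂)
    rintro ⟨_, _, _, _, _⟩ ⟨_, _, _, _, _⟩ h
    simp only [Prod.mk.injEq] at h ⊢
    tauto
  rw [h2, h4] at h1
  rw [h1, auxLaw]
  ring

end AuxiliaryLaw

/-! ### Corner points and attainment of the minimum. -/

section Attained

variable {𝒳 𝒴₁ 𝒴₂ 𝒰₁ 𝒰₂ : Type*} [Fintype 𝒳] [Fintype 𝒴₁] [Fintype 𝒴₂] [Fintype 𝒰₁] [Fintype 𝒰₂]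
  {P : 𝒳 × 𝒴₁ × 𝒴₂ → ℝ}

/-- The rate-distortion tuple of successive Wyner-Ziv coding in a given order, as a function of
the information vector. -/
def corner : Fin 2 → (ℝ × ℝ × ℝ × ℝ) →ₗ[ℝ] ℝ × ℝ × ℝ
  | 0 =>
    { toFun := fun v => (v.1 - v.2.2.1, v.2.2.1, v.2.2.2)
      map_add' := fun v w => by ext <;> simp only [Prod.fst_add, Prod.snd_add]; ring
      map_smul' := fun s v => by
        ext <;> simp only [Prod.smul_fst, Prod.smul_snd, RingHom.id_apply, smul_eq_mul]; ring }
  | 1 =>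
    { toFun := fun v => (v.2.1, v.1 - v.2.1, v.2.2.2)
      map_add' := fun v w => by ext <;> simp only [Prod.fst_add, Prod.snd_add]; ring
      map_smul' := fun s v => by
        ext <;> simp only [Prod.smul_fst, Prod.smul_snd, RingHom.id_apply, smul_eq_mul]; ring }

theorem corner_zero (v : ℝ × ℝ × ℝ × ℝ) : corner 0 v = (v.1 - v.2.2.1, v.2.2.1, v.2.2.2) := rfl

theorem corner_one (v : ℝ × ℝ × ℝ × ℝ) : corner 1 v = (v.2.1, v.1 - v.2.1, v.2.2.2) := rfl

theorem corner_snd_snd (i : Fin 2) (v : ℝ × ℝ × ℝ × ℝ) : (corner i v).2.2 = v.2.2.2 := by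
  fin_cases i <;> rfl

theorem swzConstraint_auxLaw (hP : P ∈ stdSimplex ℝ (𝒳 × 𝒴₁ × 𝒴₂)) {W₁ : 𝒴₁ → 𝒰₁ → ℝ}
    {W₂ : 𝒴₂ → 𝒰₂ → ℝ} (hW₁ : IsChannel W₁) (hW₂ : IsChannel W₂) (i : Fin 2) (R₁ R₂ : ℝ) :
    SWZConstraint (auxLaw P W₁ W₂) R₁ R₂ i ↔
      (corner i (infoVector P W₁ W₂)).1 ≤ R₁ ∧ (corner i (infoVector P W₁ W₂)).2.1 ≤ R₂ := by
  have h0 := (auxLaw_mem_stdSimplex hP hW₁ hW₂).1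
  fin_cases i
  · simp only [SWZConstraint, condMutualInfo_comm h0 rvY₁,
      condMutualInfo_auxLaw₁ hP hW₁ hW₂, mutualInfo_auxLaw₂ hP hW₁ hW₂]
    rfl
  · simp only [SWZConstraint, condMutualInfo_comm h0 rvY₂,
      condMutualInfo_auxLaw₂ hP hW₁ hW₂, mutualInfo_auxLaw₁ hP hW₁ hW₂]
    exact and_comm

theorem mem_feasibleValues (hP : IsSource P) (i : Fin 2) (R₁ R₂ d : ℝ) :
    d ∈ feasibleValues P i R₁ R₂ ↔ ∃ (n₁ n₂ : ℕ) (W₁ : 𝒴₁ → Fin n₁ → ℝ) (W₂ : 𝒴₂ → Fin n₂ → ℝ),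
      IsChannel W₁ ∧ IsChannel W₂ ∧ (corner i (infoVector P W₁ W₂)).1 ≤ R₁ ∧
        (corner i (infoVector P W₁ W₂)).2.1 ≤ R₂ ∧ d = (corner i (infoVector P W₁ W₂)).2.2 := by
  constructor
  · rintro ⟨n₁, n₂, μ, hμ, hc, rfl⟩
    obtain ⟨W₁, W₂, hW₁, hW₂, rfl⟩ := hμ.exists_channels
    rw [swzConstraint_auxLaw hP.pmf hW₁ hW₂] at hc
    exact ⟨n₁, n₂, W₁, W₂, hW₁, hW₂, hc.1, hc.2, by
      rw [corner_snd_snd, condEntropy_auxLaw_X hP.pmf hW₁ hW₂]⟩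
  · rintro ⟨n₁, n₂, W₁, W₂, hW₁, hW₂, h1, h2, rfl⟩
    exact ⟨n₁, n₂, auxLaw P W₁ W₂, isAuxiliaryLaw_auxLaw hP hW₁ hW₂,
      (swzConstraint_auxLaw hP.pmf hW₁ hW₂ i R₁ R₂).2 ⟨h1, h2⟩, by
        rw [corner_snd_snd, condEntropy_auxLaw_X hP.pmf hW₁ hW₂]⟩

theorem isCompact_setOf_isChannel (α β : Type*) [Fintype β] :
    IsCompact {W : α → β → ℝ | IsChannel W} := by
  convert isCompact_univ_pi fun _ : α => isCompact_stdSimplex ℝ β using 1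
  ext W
  simp [IsChannel]

/-- `exists_infoVector_eq` replaces the unbounded alphabets by fixed ones; channel pairs there form
a compact set, cut by closed rate constraints and mapped continuously to the distortion. -/
theorem isCompact_feasibleValues (hP : IsSource P) (i : Fin 2) (R₁ R₂ : ℝ) :
    IsCompact (feasibleValues P i R₁ R₂) := by
  have hcont := (LinearMap.continuous_of_finiteDimensional (corner i)).comp
    (continuous_infoVector P
      (𝒰₁ := Fin (Fintype.card 𝒴₁ + Module.finrank ℝ (ℝ × ℝ × ℝ × ℝ)))
      (𝒰₂ := Fin (Fintype.card 𝒴₂ + Module.finrank ℝ (ℝ × ℝ × ℝ × ℝ))))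
  have hK := ((isCompact_setOf_isChannel 𝒴₁ _).prod (isCompact_setOf_isChannel 𝒴₂ _)).inter_right
    ((isClosed_le hcont.fst (continuous_const (y := R₁))).inter
      (isClosed_le hcont.snd.fst (continuous_const (y := R₂))))
  convert hK.image hcont.snd.snd using 1
  ext d
  rw [mem_feasibleValues hP]
  constructor
  · rintro ⟨n₁, n₂, W₁, W₂, hW₁, hW₂, h1, h2, rfl⟩
    obtain ⟨V₁, V₂, hV₁, hV₂, h⟩ := exists_infoVector_eq hP.pmf hW₁ hW₂
    refine ⟨(V₁, V₂), ⟨⟨hV₁, hV₂⟩, ?_, ?_⟩, ?_⟩ <;> simp only [Set.mem_ofPred_eq,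
      Function.comp_apply, h, h1, h2]
  · rintro ⟨⟨V₁, V₂⟩, ⟨⟨hV₁, hV₂⟩, h1, h2⟩, rfl⟩
    exact ⟨_, _, V₁, V₂, hV₁, hV₂, h1, h2, rfl⟩

theorem mem_RDSucc (hP : IsSource P) (i : Fin 2) (r : ℝ × ℝ × ℝ) :
    r ∈ RDSucc P i ↔ ∃ (n₁ n₂ : ℕ) (W₁ : 𝒴₁ → Fin n₁ → ℝ) (W₂ : 𝒴₂ → Fin n₂ → ℝ),
      IsChannel W₁ ∧ IsChannel W₂ ∧ corner i (infoVector P W₁ W₂) ≤ r := by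
  rw [RDSucc, Set.mem_ofPred_eq, distortionRate]
  constructor
  · intro h
    have hne : (feasibleValues P i r.1 r.2.1).Nonempty := by
      by_contra hne
      rw [Set.not_nonempty_iff_eq_empty.1 hne, Set.image_empty, sInf_empty, top_le_iff] at h
      exact EReal.coe_ne_top _ h
    obtain ⟨d, hd⟩ := (isCompact_feasibleValues hP i r.1 r.2.1).exists_isLeast hne
    have hle : d ≤ r.2.2 := by
      rw [← EReal.coe_le_coe_iff]
      refine le_trans (le_sInf ?_) h
      rintro _ ⟨e, he, rfl⟩
      exact EReal.coe_le_coe_iff.2 (hd.2 he)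
    obtain ⟨n₁, n₂, W₁, W₂, hW₁, hW₂, h1, h2, rfl⟩ := (mem_feasibleValues hP _ _ _ _).1 hd.1
    exact ⟨n₁, n₂, W₁, W₂, hW₁, hW₂, h1, h2, hle⟩
  · rintro ⟨n₁, n₂, W₁, W₂, hW₁, hW₂, h1, h2, h3⟩
    exact le_trans (sInf_le (Set.mem_image_of_mem _ ((mem_feasibleValues hP _ _ _ _).2
      ⟨n₁, n₂, W₁, W₂, hW₁, hW₂, h1, h2, rfl⟩))) (EReal.coe_le_coe_iff.2 h3)

end Attained

/-! ### The rate-distortion region in terms of averaged information vectors. -/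

section RD

variable {𝒳 𝒴₁ 𝒴₂ : Type*} [Fintype 𝒳] [Fintype 𝒴₁] [Fintype 𝒴₂] {P : 𝒳 × 𝒴₁ × 𝒴₂ → ℝ}

theorem mem_RD (hP : P ∈ stdSimplex ℝ (𝒳 × 𝒴₁ × 𝒴₂)) (r : ℝ × ℝ × ℝ) :
    r ∈ RD P ↔ ∃ m n₁ n₂ : ℕ, m ≤ 4 ∧ n₁ ≤ Fintype.card 𝒴₁ ∧ n₂ ≤ Fintype.card 𝒴₂ ∧
      ∃ (pQ : Fin m → ℝ) (W₁ : Fin m → 𝒴₁ → Fin n₁ → ℝ) (W₂ : Fin m → 𝒴₂ → Fin n₂ → ℝ),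
      pQ ∈ stdSimplex ℝ (Fin m) ∧ (∀ q, IsChannel (W₁ q)) ∧ (∀ q, IsChannel (W₂ q)) ∧
      ∑ q, pQ q * ((infoVector P (W₁ q) (W₂ q)).1 - (infoVector P (W₁ q) (W₂ q)).2.2.1) ≤ r.1 ∧
      ∑ q, pQ q * ((infoVector P (W₁ q) (W₂ q)).1 - (infoVector P (W₁ q) (W₂ q)).2.1) ≤ r.2.1 ∧
      ∑ q, pQ q * (infoVector P (W₁ q) (W₂ q)).1 ≤ r.1 + r.2.1 ∧
      ∑ q, pQ q * (infoVector P (W₁ q) (W₂ q)).2.2.2 ≤ r.2.2 := by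
  refine exists_congr fun m => exists_congr fun n₁ => exists_congr fun n₂ =>
    and_congr_right fun _ => and_congr_right fun _ => and_congr_right fun _ =>
    exists_congr fun pQ => exists_congr fun W₁ => exists_congr fun W₂ =>
    and_congr_right fun _ => and_congr_right fun hW₁ => and_congr_right fun hW₂ => ?_
  have hν := timeSharingLaw_mk P pQ W₁ W₂
  have e1 := condMutualInfo_mixture hν rvU₁ rvY₁ rvU₂
  have e2 := condMutualInfo_mixture hν rvU₂ rvY₂ rvU₁
  have e3 := condMutualInfo_mixture_fst hν
    (fun q => (auxLaw_mem_stdSimplex hP (hW₁ q) (hW₂ q)).2)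
    (fun ω => (rvU₁ ω, rvU₂ ω)) (fun ω => (rvY₁ ω, rvY₂ ω))
  have e4 := condEntropy_mixture hν rvX fun ω => (rvU₁ ω, rvU₂ ω)
  have e5 := condEntropy_equiv_comp_right (timeSharingLaw P pQ W₁ W₂) (fun ω => rvX ω.2)
    (fun ω => ((rvU₁ ω.2, rvU₂ ω.2), ω.1)) (Equiv.prodAssoc (Fin n₁) (Fin n₂) (Fin m))
  simp only [Equiv.prodAssoc_apply] at e5
  rw [e1, e2, e3, e5, e4]
  simp only [fun q => condMutualInfo_auxLaw₁ hP (hW₁ q) (hW₂ q),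
    fun q => condMutualInfo_auxLaw₂ hP (hW₁ q) (hW₂ q),
    fun q => mutualInfo_auxLaw hP (hW₁ q) (hW₂ q),
    fun q => condEntropy_auxLaw_X hP (hW₁ q) (hW₂ q)]

end RD

/-! ### The two inclusions. -/

section RegionEquality

variable {𝒳 𝒴₁ 𝒴₂ : Type*} [Fintype 𝒳] [Fintype 𝒴₁] [Fintype 𝒴₂] {P : 𝒳 × 𝒴₁ × 𝒴₂ → ℝ}

/-- A point of the rate region is dominated by a convex combination of the two corner points. -/
theorem exists_convex_combination_corner_le {v : ℝ × ℝ × ℝ × ℝ} {r : ℝ × ℝ × ℝ}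
    (hv : v.1 ≤ v.2.1 + v.2.2.1) (h1 : v.1 - v.2.2.1 ≤ r.1) (h2 : v.1 - v.2.1 ≤ r.2.1)
    (h3 : v.1 ≤ r.1 + r.2.1) (h4 : v.2.2.2 ≤ r.2.2) :
    ∃ s t : ℝ, 0 ≤ s ∧ 0 ≤ t ∧ s + t = 1 ∧ s • corner 0 v + t • corner 1 v ≤ r := by
  -- `l` is the rate shifted from encoder 2 to encoder 1, starting at `corner 0`: just enough to
  -- meet `r.2.1`. The shift that reaches `corner 1` is `v.2.1 + v.2.2.1 - v.1`; if it is zero, the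
  -- corners coincide and `t = 0` works.
  obtain ⟨l, hl0, hlv, hl1, hl2⟩ : ∃ l : ℝ, 0 ≤ l ∧ l ≤ v.2.1 + v.2.2.1 - v.1 ∧
      l ≤ r.1 - v.1 + v.2.2.1 ∧ v.2.2.1 - r.2.1 ≤ l := by
    refine ⟨max 0 (v.2.2.1 - r.2.1), le_max_left _ _, max_le ?_ ?_, max_le ?_ ?_,
      le_max_right _ _⟩ <;> linarith
  obtain ⟨t, ht0, ht1, htl⟩ : ∃ t : ℝ, 0 ≤ t ∧ t ≤ 1 ∧ t * (v.2.1 + v.2.2.1 - v.1) = l := by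
    rcases (hl0.trans hlv).eq_or_lt with h | h
    · exact ⟨0, le_rfl, zero_le_one, by linarith⟩
    · exact ⟨l / _, div_nonneg hl0 h.le, (div_le_one h).2 hlv, div_mul_cancel₀ _ h.ne'⟩
  refine ⟨1 - t, t, by linarith, ht0, by ring, ?_, ?_, ?_⟩ <;>
  simp only [corner_zero, corner_one, Prod.smul_mk, Prod.mk_add_mk, smul_eq_mul] <;> linarith

theorem RD_subset_convexHull (hP : IsSource P) :
    RD P ⊆ convexHull ℝ (RDSucc P 0 ∪ RDSucc P 1) := by
  intro r hr
  obtain ⟨m, n₁, n₂, -, -, -, pQ, W₁, W₂, hpQ, hW₁, hW₂, h1, h2, h3, h4⟩ := (mem_RD hP.pmf r).1 hr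
  set v := ∑ q, pQ q • infoVector P (W₁ q) (W₂ q) with hv
  have e1 : v.1 = ∑ q, pQ q * (infoVector P (W₁ q) (W₂ q)).1 := by simp [hv, Prod.fst_sum]
  have e2 : v.2.1 = ∑ q, pQ q * (infoVector P (W₁ q) (W₂ q)).2.1 := by
    simp [hv, Prod.fst_sum, Prod.snd_sum]
  have e3 : v.2.2.1 = ∑ q, pQ q * (infoVector P (W₁ q) (W₂ q)).2.2.1 := by
    simp [hv, Prod.fst_sum, Prod.snd_sum]
  have e4 : v.2.2.2 = ∑ q, pQ q * (infoVector P (W₁ q) (W₂ q)).2.2.2 := by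
    simp [hv, Prod.snd_sum]
  simp only [mul_sub, Finset.sum_sub_distrib, ← e1, ← e2, ← e3, ← e4] at h1 h2 h3 h4
  have hle : v.1 ≤ v.2.1 + v.2.2.1 := by
    rw [e1, e2, e3, ← Finset.sum_add_distrib]
    refine Finset.sum_le_sum fun q _ => ?_
    rw [← mul_add]
    exact mul_le_mul_of_nonneg_left (infoVector_fst_le hP.pmf (hW₁ q) (hW₂ q)) (hpQ.1 q)
  obtain ⟨s, t, hs, ht, hst, hr⟩ := exists_convex_combination_corner_le hle h1 h2 h3 h4
  -- Adding the same nonnegative slack to both corners makes their convex combination equal to `r`,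
  -- and each shifted corner is an average over `q` of points of `RDSucc P i`.
  have hmem : ∀ i, corner i v + (r - (s • corner 0 v + t • corner 1 v)) ∈
      convexHull ℝ (RDSucc P i) := by
    intro i
    have : corner i v + (r - (s • corner 0 v + t • corner 1 v)) =
        ∑ q, pQ q • (corner i (infoVector P (W₁ q) (W₂ q)) +
          (r - (s • corner 0 v + t • corner 1 v))) := by
      simp only [smul_add, Finset.sum_add_distrib, ← Finset.sum_smul, hpQ.2, one_smul]
      rw [hv, map_sum]
      simp only [map_smul]
    rw [this]
    refine (convex_convexHull ℝ _).sum_mem (fun q _ => hpQ.1 q) hpQ.2 fun q _ =>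
      subset_convexHull ℝ _ ((mem_RDSucc hP i _).2 ⟨n₁, n₂, W₁ q, W₂ q, hW₁ q, hW₂ q, ?_⟩)
    exact le_add_of_nonneg_right (sub_nonneg.2 hr)
  have h := convex_convexHull ℝ _ (convexHull_mono Set.subset_union_left (hmem 0))
    (convexHull_mono Set.subset_union_right (hmem 1)) hs ht hst
  convert h using 1
  rw [smul_add, smul_add, add_add_add_comm, ← add_smul, hst, one_smul]
  abel

/-- The tuples that satisfy the constraints of `RD` without time sharing. -/
def RDSingle (P : 𝒳 × 𝒴₁ × 𝒴₂ → ℝ) : Set (ℝ × ℝ × ℝ) :=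
  {r | ∃ (W₁ : 𝒴₁ → Fin (Fintype.card 𝒴₁) → ℝ) (W₂ : 𝒴₂ → Fin (Fintype.card 𝒴₂) → ℝ),
    IsChannel W₁ ∧ IsChannel W₂ ∧
    (infoVector P W₁ W₂).1 - (infoVector P W₁ W₂).2.2.1 ≤ r.1 ∧
    (infoVector P W₁ W₂).1 - (infoVector P W₁ W₂).2.1 ≤ r.2.1 ∧
    (infoVector P W₁ W₂).1 ≤ r.1 + r.2.1 ∧ (infoVector P W₁ W₂).2.2.2 ≤ r.2.2}

/-- A corner makes the sum-rate constraint and one individual constraint tight; the other individual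
constraint is I(U₁;U₂) ≥ 0, from `infoVector_fst_le`. -/
theorem mem_RDSingle_of_corner_le (hP : IsSource P) {W₁ : 𝒴₁ → Fin (Fintype.card 𝒴₁) → ℝ}
    {W₂ : 𝒴₂ → Fin (Fintype.card 𝒴₂) → ℝ} (hW₁ : IsChannel W₁) (hW₂ : IsChannel W₂) (i : Fin 2)
    {r : ℝ × ℝ × ℝ} (h : corner i (infoVector P W₁ W₂) ≤ r) : r ∈ RDSingle P := by
  have hle := infoVector_fst_le hP.pmf hW₁ hW₂
  obtain ⟨h1, h2, h3⟩ := h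
  refine ⟨W₁, W₂, hW₁, hW₂, ?_⟩
  fin_cases i <;> simp only [Fin.zero_eta, Fin.mk_one, corner_zero, corner_one] at h1 h2 h3 <;>
    refine ⟨?_, ?_, ?_, ?_⟩ <;> linarith

theorem RDSucc_subset_convexHull_RDSingle (hP : IsSource P) (i : Fin 2) :
    RDSucc P i ⊆ convexHull ℝ (RDSingle P) := by
  intro r hr
  obtain ⟨n₁, n₂, W₁, W₂, hW₁, hW₂, h⟩ := (mem_RDSucc hP i r).1 hr
  -- The vectors whose corner, shifted by the slack of `r`, lies in the hull form a convex set, so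
  -- checking small alphabets is enough.
  have hconv := ((convex_convexHull ℝ (RDSingle P)).translate_preimage_left
    (r - corner i (infoVector P W₁ W₂))).linear_preimage (corner i)
  have := convexHull_min ?_ hconv (infoVector_mem_convexHull hP.pmf hW₁ hW₂)
  · simpa using this
  · rintro _ ⟨V₁, V₂, hV₁, hV₂, rfl⟩
    exact subset_convexHull ℝ _ (mem_RDSingle_of_corner_le hP hV₁ hV₂ i
      (le_add_of_nonneg_right (sub_nonneg.2 h)))

theorem convexHull_RDSingle_subset_RD (hP : IsSource P) : convexHull ℝ (RDSingle P) ⊆ RD P := by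
  intro r hr
  obtain ⟨ι, _, z, w, hz, hind, hw, hw1, rfl⟩ := eq_pos_convex_span_of_mem_convexHull hr
  choose W₁ W₂ hW₁ hW₂ h1 h2 h3 h4 using fun q => hz ⟨q, rfl⟩
  -- Affinely independent points in ℝ³ number at most 3 + 1.
  have hcard : Fintype.card ι ≤ 4 := by
    refine hind.card_le_finrank_succ.trans (Nat.succ_le_succ ((Submodule.finrank_le _).trans ?_))
    simp
  let e := (Fintype.equivFin ι).symm
  refine (mem_RD hP.pmf _).2 ⟨Fintype.card ι, _, _, hcard, le_rfl, le_rfl, w ∘ e, W₁ ∘ e, W₂ ∘ e,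
    ⟨fun q => (hw _).le, (e.sum_comp w).trans hw1⟩, fun q => hW₁ _, fun q => hW₂ _, ?_⟩
  have key : ∀ {F G : ι → ℝ}, (∀ q, F q ≤ G q) → ∑ q, w (e q) * F (e q) ≤ ∑ q, w q * G q :=
    fun {F G} hFG => (e.sum_comp fun q => w q * F q).trans_le
      (Finset.sum_le_sum fun q _ => mul_le_mul_of_nonneg_left (hFG q) (hw q).le)
  simp only [Prod.fst_sum, Prod.snd_sum, Prod.smul_fst, Prod.smul_snd, smul_eq_mul,
    ← Finset.sum_add_distrib, ← mul_add]
  exact ⟨key h1, key h2, key h3, key h4⟩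

end RegionEquality

end CEO

theorem proposition1 {𝒳 𝒴₁ 𝒴₂ : Type*} [Fintype 𝒳] [Fintype 𝒴₁] [Fintype 𝒴₂]
    (P : 𝒳 × 𝒴₁ × 𝒴₂ → ℝ) (hP : CEO.IsSource P) :
    (∀ (i : Fin 2) (R₁ R₂ : ℝ), (CEO.feasibleValues P i R₁ R₂).Nonempty →
      ∃ d, IsLeast (CEO.feasibleValues P i R₁ R₂) d) ∧
    CEO.RD P = convexHull ℝ (CEO.RDSucc P 0 ∪ CEO.RDSucc P 1) := by
  refine ⟨fun i R₁ R₂ h => (CEO.isCompact_feasibleValues hP i R₁ R₂).exists_isLeast h,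
    (CEO.RD_subset_convexHull hP).antisymm ?_⟩
  exact (convexHull_min (Set.union_subset (CEO.RDSucc_subset_convexHull_RDSingle hP 0)
    (CEO.RDSucc_subset_convexHull_RDSingle hP 1)) (convex_convexHull ℝ _)).trans
    (CEO.convexHull_RDSingle_subset_RD hP)
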